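/- Let $\mathbb{F}$ be a field and $m\ge 1$ an integer. Let $X^{(0)}=\{x_{i,j} : i\in[4],\,j\in[2]\}$ and $$P^{(0)}=\sum_{a\in\{1,2\}}\ \sum_{b\in\{3,4\}} x_{a,1}\,x_{a,2}\,x_{b,1}\,x_{b,2}.$$ For $\Delta\ge 0$ let $X^{(\Delta+1)}$ be the disjoint union of $2m$ copies $X^{(\Delta+1)}_{i,j}$ ($i\in[m]$, $j\in[2]$) of $X^{(\Delta)}$, and let $$P^{(\Delta+1)}=\prod_{i\in[m]}\Bigl(P^{(\Delta)}\bigl(X^{(\Delta+1)}_{i,1}\bigr)+P^{(\Delta)}\bigl(X^{(\Delta+1)}_{i,2}\bigr)\Bigr)\in\mathbb{F}\bigl[X^{(\Delta+1)}\bigr].$$ Put $n_\Delta=|X^{(\Delta)}|=8(2m)^\Delta$. An algebraic circuit is a directed acyclic graph whose input gates are labelled by variables or elements of $\mathbb{F}$ and whose other gates are sum or product gates of unbounded fan-in; wires may carry scalar labels from $\mathbb{F}$. The circuit has a designated output gate, and the polynomial computed there is the polynomial that the circuit computes. Input gates may also be labelled by variables outside $X^{(\Delta)}$. The size of a circuit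 is its number of gates, input gates included; its product-depth is the maximum number of product gates on a path from an input gate to the output gate. A circuit is multilinear if every gate computes a polynomial of degree at most $1$ in each variable. There is an absolute constant $c>0$ such that the following holds. Let $(m_r)_{r\in\mathbb{N}}$ and $(\Delta_r)_{r\in\mathbb{N}}$ be sequences of natural numbers with $m_r\to\infty$, $\Delta_r\ge 1$ for all $r$, and $\Delta_r=m_r^{o(1)}$, i.e. for every $\varepsilon>0$ we have $\Delta_r\le m_r^{\varepsilon}$ for all sufficiently large $r$. Then for all sufficiently large $r$, with $m=m_r$ and $\Delta=\Delta_r$: over every field $\mathbb{F}$, every multilinear circuit of product-depth at most $\Delta$ computing $P^{(\Delta)}$ has size at least $\exp(m^{c})$ and at least $\exp\bigl(n_\Delta^{\,c/\Delta}\bigr)$. -/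

import Mathlib

open scoped BigOperators

/-! ## Hard polynomials -/

namespace HardPoly

/-- The variable set `X^(Δ)` (with parameter `m`): `X^(0)` consists of the eight variables
`x_{i,j}` with `i ∈ [4]`, `j ∈ [2]`, and `X^(Δ+1)` is the disjoint union of `2m` copies of
`X^(Δ)`, labelled by `(i, j) ∈ [m] × [2]`. -/
def Vars (m : ℕ) : ℕ → Type
  | 0 => Fin 4 × Fin 2
  | Δ + 1 => (Fin m × Fin 2) × Vars m Δ

/-- The number of variables: `n_0 = 8` and `n_{Δ+1} = 2 m n_Δ`. -/
def numVars (m : ℕ) : ℕ → ℕ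
  | 0 => 8
  | Δ + 1 => 2 * m * numVars m Δ

theorem card_vars (m Δ : ℕ) : Nat.card (Vars m Δ) = numVars m Δ := by
  induction Δ with
  | zero => simp [Vars, numVars]
  | succ Δ ih =>
    simp only [Vars, numVars, Nat.card_prod, Nat.card_fin, ih]
    ring

theorem numVars_eq (m Δ : ℕ) : numVars m Δ = 8 * (2 * m) ^ Δ := by
  induction Δ with
  | zero => rfl
  | succ Δ ih => simp only [numVars, ih]; ring

/-- The variable `x_{i,j}` of `X^(0)`, as a polynomial (indices starting at `0`). -/
noncomputable def baseVar (F : Type*) [Field F] (m : ℕ) (i : Fin 4) (j : Fin 2) :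
    MvPolynomial (Vars m 0) F :=
  MvPolynomial.X (show Vars m 0 from (i, j))

/-- The hard polynomial `P^(Δ) ∈ F[X^(Δ)]`:
`P^(0) = ∑_{a ∈ {1,2}, b ∈ {3,4}} x_{a,1} x_{a,2} x_{b,1} x_{b,2}` and
`P^(Δ+1) = ∏_{i ∈ [m]} (P^(Δ)(X_{i,1}) + P^(Δ)(X_{i,2}))`. Indices start at `0` in the code. -/
noncomputable def hardPoly (F : Type*) [Field F] (m : ℕ) :
    (Δ : ℕ) → MvPolynomial (Vars m Δ) F
  | 0 => ∑ a ∈ ({0, 1} : Finset (Fin 4)), ∑ b ∈ ({2, 3} : Finset (Fin 4)),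
      baseVar F m a 0 * baseVar F m a 1 * baseVar F m b 0 * baseVar F m b 1
  | Δ + 1 => ∏ i : Fin m, ∑ j : Fin 2,
      MvPolynomial.rename (fun x : Vars m Δ => (show Vars m (Δ + 1) from ((i, j), x)))
        (hardPoly F m Δ)

end HardPoly

/-! ## Algebraic circuits -/

/-- A gate with predecessors among `k` earlier gates: an input gate (a variable or a field
element), or a sum or product gate of arbitrary fan-in `d`. The `t`-th wire entering a sum or
product gate comes from the gate `child t` and carries the scalar label `a t`
(`a t = 1` is an unlabelled wire). -/
inductive Gate (F : Type*) (σ : Type*) (k : ℕ) where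
  | var (x : σ) : Gate F σ k
  | const (a : F) : Gate F σ k
  | sum (d : ℕ) (a : Fin d → F) (child : Fin d → Fin k) : Gate F σ k
  | prod (d : ℕ) (a : Fin d → F) (child : Fin d → Fin k) : Gate F σ k

/-- An algebraic circuit over `F` with variables `σ`: a directed acyclic graph of gates, listed in
a topological order, with a designated output gate. The size is the number of gates, including
the input gates. -/
structure Circuit (F : Type*) (σ : Type*) where
  size : ℕ
  gate : (i : Fin size) → Gate F σ i
  output : Fin size

namespace Circuit

variable {F : Type*} {σ : Type*}

/-- The polynomial computed by the gate `i`. -/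
noncomputable def gatePoly [Field F] (C : Circuit F σ) (i : Fin C.size) : MvPolynomial σ F :=
  match C.gate i with
  | .var x => MvPolynomial.X x
  | .const a => MvPolynomial.C a
  | .sum _ a child =>
      ∑ t, MvPolynomial.C (a t) * C.gatePoly ⟨child t, (child t).isLt.trans i.isLt⟩
  | .prod _ a child =>
      ∏ t, (MvPolynomial.C (a t) * C.gatePoly ⟨child t, (child t).isLt.trans i.isLt⟩)
termination_by i.val
decreasing_by all_goals exact (child t).isLt

/-- The largest number of product gates on a path from an input gate to the gate `i`
(the gate `i` itself included). -/
def gateProductDepth (C : Circuit F σ) (i : Fin C.size) : ℕ :=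
  match C.gate i with
  | .var _ => 0
  | .const _ => 0
  | .sum _ _ child =>
      Finset.univ.sup fun t =>
        C.gateProductDepth ⟨child t, (child t).isLt.trans i.isLt⟩
  | .prod _ _ child =>
      1 + Finset.univ.sup fun t =>
        C.gateProductDepth ⟨child t, (child t).isLt.trans i.isLt⟩
termination_by i.val
decreasing_by all_goals exact (child t).isLt

/-- The product-depth of a circuit. -/
def productDepth (C : Circuit F σ) : ℕ := C.gateProductDepth C.output

/-- A circuit computes the polynomial of its output gate. -/
def Computes [Field F] (C : Circuit F σ) (p : MvPolynomial σ F) : Prop :=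
  C.gatePoly C.output = p

/-- A circuit is multilinear if every gate computes a multilinear polynomial, that is, one of
degree at most `1` in each variable. -/
def IsMultilinear [Field F] (C : Circuit F σ) : Prop :=
  ∀ i : Fin C.size, ∀ x : σ, (C.gatePoly i).degreeOf x ≤ 1

end Circuit

/-! The measure is the rank of an evaluation matrix. A restriction makes each variable a row
variable y, a column variable z, or a constant, and `relrk` divides the rank by 2^((#y + #z)/2). For
a function of the variables in question it is at most 1, and at most 1/√2 when the numbers of y and
z differ. It is subadditive on sums, and submultiplicative on products over a partition of the
variables.

The restriction is random and recursive (`sampleLabel`). A block P(X_{i,1}) + P(X_{i,2}) is alive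
with probability 1/2: its second copy is set to zero and its first copy is restricted recursively.
Otherwise it collapses to y + z with one free variable in each copy; the one in the first copy sits
at a uniformly random leaf, and a random sign decides which of the two is the row variable. In every
outcome the hard polynomial is a product of y + z over disjoint pairs, so its `relrk` is at least 1
(`one_le_relrk_hardFun`).

Over a field, multilinearity forces the nonzero factors of a product gate to use disjoint variables,
so a circuit of size s is an iterated sum of at most s products of functions on disjoint sets
(`comp_of_computes`). `RankBound`, proved by induction on the depth, says that at most n such
functions which see most leaves of n copies have expected product of `relrk` at most (24/25)^n. For
n = 1 this contradicts full rank.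

In the inductive step, expanding every function gives s^n terms, each a product over disjoint parts
of smaller depth; it suffices that each term has expectation at most 2(24/25)^(Kn) with K of order
log s. This is `block_bound`, with M = Kn and nm blocks. If M parts carry almost all of the leaves,
or if many blocks are dominated by a single part each, then M alive blocks together with at most M
parts satisfy the induction hypothesis (`alive_bound`). Otherwise the parts are spread out: very
likely more than M of them contain exactly one variable of some pair y + z, and the random signs
then unbalance many of these (`split_bound`). The union bounds cost K log |V|, which must stay below
about m/Δ; this limits K and hence log s. -/

namespace CircuitBound

open Finset HardPoly

/-- The value a restriction gives to a variable: a row variable, a column variable, or one of the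
constants `0` and `1`. -/
inductive Label
  | y
  | z
  | zero
  | one
deriving DecidableEq

/-! ### Rank of evaluation matrices and its normalization. -/

section Rank

variable {F : Type*} [Field F] {V : Type*}

/-- The point of `F^V` given by a labelling, a row index `a` and a column index `b`. -/
def point (F : Type*) [Field F] (lab : V → Label) (a b : V → Bool) (v : V) : F :=
  match lab v with
  | .y => if a v then 1 else 0
  -- With y in {0, 1} and z in {0, -1}, the sum y + z vanishes exactly when the two bits agree and
  -- is ±1 otherwise, in every characteristic.
  | .z => if b v then -1 else 0
  | .zero => 0
  | .one => 1

/-- The evaluation matrix of `h` under the labelling `lab` is a sum of `r` matrices of rank one. -/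
def RankLE (lab : V → Label) (h : (V → F) → F) (r : ℕ) : Prop :=
  ∃ u w : Fin r → (V → Bool) → F, ∀ a b, h (point F lab a b) = ∑ i, u i a * w i b

theorem RankLE.of_finset {ι : Type*} {lab : V → Label} {h : (V → F) → F} (s : Finset ι)
    (u w : ι → (V → Bool) → F) (H : ∀ a b, h (point F lab a b) = ∑ i ∈ s, u i a * w i b) :
    RankLE lab h #s := by
  refine ⟨fun i => u (s.equivFin.symm i), fun i => w (s.equivFin.symm i), fun a b => ?_⟩
  rw [H, ← Finset.sum_coe_sort]
  exact Fintype.sum_equiv s.equivFin _ _ (by simp)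

/-- The rank of the evaluation matrix of `h` under the labelling `lab`. -/
noncomputable def rk (lab : V → Label) (h : (V → F) → F) : ℕ := sInf {r | RankLE lab h r}

theorem rk_le {lab : V → Label} {h : (V → F) → F} {r : ℕ} (H : RankLE lab h r) :
    rk lab h ≤ r := Nat.sInf_le H

theorem rankLE_rk [Fintype V] (lab : V → Label) (h : (V → F) → F) : RankLE lab h (rk lab h) := by
  classical
  refine Nat.sInf_mem (s := {r | RankLE lab h r}) ⟨_, RankLE.of_finset (univ : Finset (V → Bool))
    (fun i a => if a = i then 1 else 0) (fun i b => h (point F lab i b)) fun a b => ?_⟩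
  simp

theorem RankLE.add {lab : V → Label} {h k : (V → F) → F} {r s : ℕ} (hh : RankLE lab h r)
    (hk : RankLE lab k s) : RankLE lab (fun x => h x + k x) (r + s) := by
  obtain ⟨u, w, H⟩ := hh
  obtain ⟨u', w', H'⟩ := hk
  have := RankLE.of_finset (lab := lab) (h := fun x => h x + k x)
    (univ : Finset (Fin r ⊕ Fin s)) (Sum.elim u u') (Sum.elim w w') (by simp [H, H'])
  simpa using this

theorem RankLE.mul {lab : V → Label} {h k : (V → F) → F} {r s : ℕ} (hh : RankLE lab h r)
    (hk : RankLE lab k s) : RankLE lab (fun x => h x * k x) (r * s) := by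
  obtain ⟨u, w, H⟩ := hh
  obtain ⟨u', w', H'⟩ := hk
  have := RankLE.of_finset (lab := lab) (h := fun x => h x * k x)
    (univ : Finset (Fin r × Fin s)) (fun p a => u p.1 a * u' p.2 a)
    (fun p b => w p.1 b * w' p.2 b) (by
      intro a b
      rw [H, H', Finset.sum_mul_sum, ← Finset.univ_product_univ, Finset.sum_product]
      exact Finset.sum_congr rfl fun i _ => Finset.sum_congr rfl fun j _ => by ring)
  simpa using this

theorem RankLE.const_mul {lab : V → Label} {h : (V → F) → F} {r : ℕ} (c : F)
    (hh : RankLE lab h r) : RankLE lab (fun x => c * h x) r := by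
  obtain ⟨u, w, H⟩ := hh
  refine ⟨fun i a => c * u i a, w, fun a b => ?_⟩
  simp only [H, Finset.mul_sum, mul_assoc]

theorem RankLE.zero (lab : V → Label) : RankLE (F := F) lab (fun _ => 0) 0 :=
  ⟨fun _ _ => 0, fun _ _ => 0, by simp⟩

theorem RankLE.const (lab : V → Label) (c : F) : RankLE lab (fun _ => c) 1 :=
  ⟨fun _ _ => c, fun _ _ => 1, by simp⟩

theorem RankLE.sum {ι : Type*} {lab : V → Label} {h : ι → (V → F) → F} {r : ι → ℕ} (s : Finset ι)
    (H : ∀ i ∈ s, RankLE lab (h i) (r i)) :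
    RankLE lab (fun x => ∑ i ∈ s, h i x) (∑ i ∈ s, r i) := by
  classical
  induction s using Finset.induction_on with
  | empty => simpa using RankLE.zero lab
  | insert i s hi ih =>
    simp only [Finset.sum_insert hi]
    exact (H i (by simp)).add (ih fun j hj => H j (by simp [hj]))

theorem RankLE.prod {ι : Type*} {lab : V → Label} {h : ι → (V → F) → F} {r : ι → ℕ} (s : Finset ι)
    (H : ∀ i ∈ s, RankLE lab (h i) (r i)) :
    RankLE lab (fun x => ∏ i ∈ s, h i x) (∏ i ∈ s, r i) := by
  classical
  induction s using Finset.induction_on with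
  | empty => simpa using RankLE.const lab (1 : F)
  | insert i s hi ih =>
    simp only [Finset.prod_insert hi]
    exact (H i (by simp)).mul (ih fun j hj => H j (by simp [hj]))

/-- An affine function is a function of the row plus a function of the column; the variables fixed
to constants are counted with the row. -/
theorem RankLE.of_affine {lab : V → Label} (S : Finset V) (c₀ : F) (c : V → F) :
    RankLE lab (fun x => c₀ + ∑ v ∈ S, c v * x v) 2 := by
  refine ⟨![fun a => c₀ + ∑ v ∈ S, c v * point F lab a a v * (if lab v = .z then 0 else 1),
    fun _ => 1], ![fun _ => 1,
    fun b => ∑ v ∈ S, c v * point F lab b b v * (if lab v = .z then 1 else 0)], fun a b => ?_⟩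
  simp only [Fin.sum_univ_two, Matrix.cons_val_zero, Matrix.cons_val_one, mul_one, one_mul,
    add_assoc, ← Finset.sum_add_distrib]
  congr 1
  refine Finset.sum_congr rfl fun v _ => ?_
  unfold point
  cases lab v <;> simp

/-- The row matters only through the set of row variables of `S` that are switched on, so there are
at most that many distinct rows. -/
theorem RankLE.of_dependsOn_y [DecidableEq V] {lab : V → Label} {h : (V → F) → F} {S : Finset V}
    (H : DependsOn h (S : Set V)) : RankLE lab h (2 ^ #{v ∈ S | lab v = .y}) := by
  have := RankLE.of_finset (lab := lab) (h := h) ({v ∈ S | lab v = .y}).powerset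
    (fun A a => if A = {v ∈ {v ∈ S | lab v = .y} | a v = true} then 1 else 0)
    (fun A b => h (point F lab (fun v => decide (v ∈ A)) b)) (by
      intro a b
      rw [Finset.sum_eq_single {v ∈ {v ∈ S | lab v = .y} | a v = true}]
      · simp only [if_true, one_mul]
        refine H fun v hv => ?_
        unfold point
        cases hl : lab v <;> simp_all
      · intro A _ hA
        simp [hA]
      · intro hA
        exact absurd (Finset.mem_powerset.2 (Finset.filter_subset _ _)) hA)
  simpa using this

theorem RankLE.of_dependsOn_z [DecidableEq V] {lab : V → Label} {h : (V → F) → F} {S : Finset V}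
    (H : DependsOn h (S : Set V)) : RankLE lab h (2 ^ #{v ∈ S | lab v = .z}) := by
  have := RankLE.of_finset (lab := lab) (h := h) ({v ∈ S | lab v = .z}).powerset
    (fun A a => h (point F lab a (fun v => decide (v ∈ A))))
    (fun A b => if A = {v ∈ {v ∈ S | lab v = .z} | b v = true} then 1 else 0) (by
      intro a b
      rw [Finset.sum_eq_single {v ∈ {v ∈ S | lab v = .z} | b v = true}]
      · simp only [if_true, mul_one]
        refine H fun v hv => ?_
        unfold point
        cases hl : lab v <;> simp_all
      · intro A _ hA
        simp [hA]
      · intro hA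
        exact absurd (Finset.mem_powerset.2 (Finset.filter_subset _ _)) hA)
  simpa using this

/-- `1 / √2`. -/
noncomputable def theta : ℝ := (√2)⁻¹

theorem theta_pos : 0 < theta := by unfold theta; positivity

theorem theta_sq : theta ^ 2 = 1 / 2 := by
  unfold theta; rw [inv_pow, Real.sq_sqrt (by norm_num)]; norm_num

theorem theta_le : theta ≤ 3 / 4 := by nlinarith [theta_sq, theta_pos]

theorem two_mul_theta_sq : 2 * (theta * theta) = 1 := by
  have := theta_sq; nlinarith

/-- The number of free variables in `S`. -/
def free (lab : V → Label) (S : Finset V) : ℕ := #{v ∈ S | lab v = .y} + #{v ∈ S | lab v = .z}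

/-- The rank of `h`, normalized by the largest possible rank of a function of the variables `S`. -/
noncomputable def relrk (lab : V → Label) (S : Finset V) (h : (V → F) → F) : ℝ :=
  rk lab h * theta ^ free lab S

theorem relrk_nonneg (lab : V → Label) (S : Finset V) (h : (V → F) → F) : 0 ≤ relrk lab S h :=
  mul_nonneg (Nat.cast_nonneg _) (pow_nonneg theta_pos.le _)

theorem two_pow_mul_theta_pow (a b : ℕ) : (2 : ℝ) ^ a * theta ^ (a + (a + b)) = theta ^ b := by
  rw [← add_assoc, pow_add, pow_add, ← mul_assoc, ← mul_pow, ← mul_pow, two_mul_theta_sq, one_pow,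
    one_mul]

/-- The rank is at most 2^min(#y, #z), while the normalization is 2^((#y + #z)/2). The exponent `n`
is the imbalance |#y - #z|. -/
theorem relrk_le_theta_pow [DecidableEq V] {lab : V → Label} {h : (V → F) → F} {S : Finset V}
    (H : DependsOn h (S : Set V)) :
    ∃ n : ℕ, relrk lab S h ≤ theta ^ n ∧
      (#{v ∈ S | lab v = .y} ≠ #{v ∈ S | lab v = .z} → n ≠ 0) := by
  rcases le_total #{v ∈ S | lab v = .y} #{v ∈ S | lab v = .z} with hle | hle
  · obtain ⟨n, hn⟩ := Nat.exists_eq_add_of_le hle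
    refine ⟨n, ?_, by omega⟩
    rw [← two_pow_mul_theta_pow #{v ∈ S | lab v = .y}, relrk, free, ← hn]
    gcongr
    · exact pow_nonneg theta_pos.le _
    · exact_mod_cast rk_le (RankLE.of_dependsOn_y H)
  · obtain ⟨n, hn⟩ := Nat.exists_eq_add_of_le hle
    refine ⟨n, ?_, by omega⟩
    rw [← two_pow_mul_theta_pow #{v ∈ S | lab v = .z}, relrk, free, ← hn,
      add_comm #{v ∈ S | lab v = .y}]
    gcongr
    · exact pow_nonneg theta_pos.le _
    · exact_mod_cast rk_le (RankLE.of_dependsOn_z H)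

theorem relrk_le_one [DecidableEq V] {lab : V → Label} {h : (V → F) → F} {S : Finset V}
    (H : DependsOn h (S : Set V)) : relrk lab S h ≤ 1 := by
  obtain ⟨n, hn, -⟩ := relrk_le_theta_pow (lab := lab) H
  exact hn.trans (pow_le_one₀ theta_pos.le (theta_le.trans (by norm_num)))

theorem relrk_le_of_ne [DecidableEq V] {lab : V → Label} {h : (V → F) → F} {S : Finset V}
    (H : DependsOn h (S : Set V)) (hne : #{v ∈ S | lab v = .y} ≠ #{v ∈ S | lab v = .z}) :
    relrk lab S h ≤ 3 / 4 := by
  obtain ⟨n, hn, h0⟩ := relrk_le_theta_pow (lab := lab) H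
  exact hn.trans ((pow_le_of_le_one theta_pos.le (theta_le.trans (by norm_num)) (h0 hne)).trans
    theta_le)

theorem free_eq_sum {ι : Type*} [DecidableEq V] (lab : V → Label) (s : Finset ι)
    (T : ι → Finset V) (hT : (s : Set ι).PairwiseDisjoint T) :
    free lab (s.biUnion T) = ∑ i ∈ s, free lab (T i) := by
  have key : ∀ c, #{v ∈ s.biUnion T | lab v = c} = ∑ i ∈ s, #{v ∈ T i | lab v = c} := by
    intro c
    rw [Finset.filter_biUnion, Finset.card_biUnion]
    intro i hi j hj hij
    exact (hT hi hj hij).mono (Finset.filter_subset _ _) (Finset.filter_subset _ _)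
  simp only [free, key, Finset.sum_add_distrib]

/-- The relative rank of a sum of products of functions of disjoint sets of variables. -/
theorem relrk_sum_prod_le [Fintype V] [DecidableEq V] {s : ℕ} {ι : Fin s → Type*}
    [∀ t, Fintype (ι t)]
    (lab : V → Label) (S : Finset V) (c : Fin s → F) (T : ∀ t, ι t → Finset V)
    (g : ∀ t, ι t → (V → F) → F) (hdisj : ∀ t, Pairwise (Function.onFun Disjoint (T t)))
    (hcov : ∀ t, univ.biUnion (T t) = S) :
    relrk lab S (fun x => ∑ t, c t * ∏ l, g t l x) ≤
      ∑ t, ∏ l, relrk lab (T t l) (g t l) := by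
  have h1 : rk lab (fun x => ∑ t, c t * ∏ l, g t l x) ≤ ∑ t, ∏ l, rk lab (g t l) :=
    rk_le (RankLE.sum _ fun t _ =>
      (RankLE.prod _ fun l _ => rankLE_rk lab (g t l)).const_mul (c t))
  calc relrk lab S (fun x => ∑ t, c t * ∏ l, g t l x)
      ≤ (∑ t, ∏ l, rk lab (g t l) : ℕ) * theta ^ free lab S := by
        unfold relrk
        gcongr
        exact pow_nonneg theta_pos.le _
    _ = _ := by
        push_cast
        rw [Finset.sum_mul]
        refine Finset.sum_congr rfl fun t _ => ?_
        simp only [relrk, Finset.prod_mul_distrib]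
        rw [← hcov t, free_eq_sum lab _ _ fun i _ j _ hij => hdisj t hij, Finset.prod_pow_eq_pow_sum]

/-- A product of `y_i + z_i` over disjoint pairs has full rank. -/
theorem two_pow_le_rk [Fintype V] {lab : V → Label} {h : (V → F) → F} {I : Type*} [Fintype I]
    (py pz : I → V) (hy : Function.Injective py) (hz : Function.Injective pz)
    (ly : ∀ i, lab (py i) = .y) (lz : ∀ i, lab (pz i) = .z)
    (H : ∀ a b, h (point F lab a b) =
      ∏ i, (point F lab a b (py i) + point F lab a b (pz i))) :
    2 ^ Fintype.card I ≤ rk lab h := by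
  classical
  obtain ⟨u, w, huw⟩ := rankLE_rk lab h
  let ea : (I → Bool) → V → Bool := fun A => Function.extend py A fun _ => false
  -- Complementing the column index makes y + z nonzero exactly when the indices agree, so the
  -- selected submatrix is diagonal with entries ±1.
  let eb : (I → Bool) → V → Bool := fun A => Function.extend pz (fun i => !A i) fun _ => false
  have hM : ∀ A B : I → Bool, h (point F lab (ea A) (eb B)) =
      if A = B then ∏ i, (if A i then 1 else -1 : F) else 0 := by
    intro A B
    have hval : ∀ i, point F lab (ea A) (eb B) (py i) + point F lab (ea A) (eb B) (pz i) =
        if A i = B i then (if A i then 1 else -1 : F) else 0 := by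
      intro i
      have e1 : ea A (py i) = A i := hy.extend_apply _ _ _
      have e2 : eb B (pz i) = !B i := hz.extend_apply _ _ _
      unfold point
      rw [ly, lz]
      simp only [e1, e2]
      cases A i <;> cases B i <;> simp
    rw [H]
    simp only [hval]
    split_ifs with hAB
    · subst hAB; simp
    · obtain ⟨i, hi⟩ := Function.ne_iff.1 hAB
      exact Finset.prod_eq_zero (Finset.mem_univ i) (by simp [hi])
  let U : Matrix (I → Bool) (Fin (rk lab h)) F := Matrix.of fun A i => u i (ea A)
  let W : Matrix (Fin (rk lab h)) (I → Bool) F := Matrix.of fun i B => w i (eb B)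
  have hUW : U * W = Matrix.diagonal fun A : I → Bool => ∏ i, (if A i then 1 else -1 : F) := by
    ext A B
    rw [Matrix.mul_apply, Matrix.diagonal_apply, ← hM A B, huw]
    rfl
  have h1 : (U * W).rank = Fintype.card (I → Bool) := by
    rw [hUW]
    apply Matrix.rank_of_isUnit
    rw [Matrix.isUnit_iff_isUnit_det, Matrix.det_diagonal, isUnit_iff_ne_zero]
    refine Finset.prod_ne_zero_iff.2 fun A _ => Finset.prod_ne_zero_iff.2 fun i _ => ?_
    split_ifs <;> simp
  have h2 : (U * W).rank ≤ rk lab h := by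
    refine (Matrix.rank_mul_le_left U W).trans ?_
    simpa using Matrix.rank_le_card_width U
  rw [h1] at h2
  simpa using h2

end Rank

/-! ### The hard polynomial as a function on points. -/

instance instFintypeVars (m : ℕ) : ∀ d, Fintype (Vars m d)
  | 0 => inferInstanceAs (Fintype (Fin 4 × Fin 2))
  | d + 1 =>
    letI := instFintypeVars m d
    inferInstanceAs (Fintype ((Fin m × Fin 2) × Vars m d))

instance instDecidableEqVars (m : ℕ) : ∀ d, DecidableEq (Vars m d)
  | 0 => inferInstanceAs (DecidableEq (Fin 4 × Fin 2))
  | d + 1 =>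
    letI := instDecidableEqVars m d
    inferInstanceAs (DecidableEq ((Fin m × Fin 2) × Vars m d))

/-- The variable `(i, j)` of the base polynomial. -/
def mk₀ {m : ℕ} (i : Fin 4) (j : Fin 2) : Vars m 0 := (i, j)

/-- The variable `x` in the copy `(i, j)`. -/
def mkSucc {m d : ℕ} (i : Fin m) (j : Fin 2) (x : Vars m d) : Vars m (d + 1) := ((i, j), x)

section Eval

variable {F : Type*} [Field F] {m : ℕ}

/-- The hard polynomial as a function. -/
noncomputable def hardFun (F : Type*) [Field F] (m d : ℕ) (p : Vars m d → F) : F :=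
  MvPolynomial.eval p (hardPoly F m d)

theorem hardFun_zero (p : Vars m 0 → F) :
    hardFun F m 0 p = (p (mk₀ 0 0) * p (mk₀ 0 1) + p (mk₀ 1 0) * p (mk₀ 1 1)) *
      (p (mk₀ 2 0) * p (mk₀ 2 1) + p (mk₀ 3 0) * p (mk₀ 3 1)) := by
  have hb : ∀ i j, MvPolynomial.eval p (baseVar F m i j) = p (mk₀ i j) :=
    fun i j => MvPolynomial.eval_X _
  have h01 : (0 : Fin 4) ∉ ({1} : Finset (Fin 4)) := by decide
  have h23 : (2 : Fin 4) ∉ ({3} : Finset (Fin 4)) := by decide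
  have h : hardPoly F m 0 = ∑ a ∈ ({0, 1} : Finset (Fin 4)), ∑ b ∈ ({2, 3} : Finset (Fin 4)),
      baseVar F m a 0 * baseVar F m a 1 * baseVar F m b 0 * baseVar F m b 1 := rfl
  have hmul : ∀ f g : MvPolynomial (Vars m 0) F, MvPolynomial.eval p (f * g) =
      MvPolynomial.eval p f * MvPolynomial.eval p g := fun f g => _root_.map_mul _ f g
  have hadd : ∀ f g : MvPolynomial (Vars m 0) F, MvPolynomial.eval p (f + g) =
      MvPolynomial.eval p f + MvPolynomial.eval p g := fun f g => _root_.map_add _ f g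
  simp only [hardFun, h, hmul, hadd, hb, Finset.sum_insert h01,
    Finset.sum_insert h23, Finset.sum_singleton]
  ring

theorem hardFun_succ (d : ℕ) (p : Vars m (d + 1) → F) :
    hardFun F m (d + 1) p = ∏ i : Fin m,
      (hardFun F m d (fun x => p (mkSucc i 0 x)) + hardFun F m d (fun x => p (mkSucc i 1 x))) := by
  have h : hardPoly F m (d + 1) = ∏ i : Fin m, ∑ j : Fin 2,
      MvPolynomial.rename (mkSucc i j) (hardPoly F m d) := rfl
  rw [hardFun, h, _root_.map_prod]
  refine Finset.prod_congr rfl fun i _ => ?_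
  rw [Fin.sum_univ_two, _root_.map_add, MvPolynomial.eval_rename, MvPolynomial.eval_rename]
  rfl

/-- This is what switches off a second copy labelled by zeros. For `m = 0` the empty product would
be 1. -/
theorem hardFun_const_zero [NeZero m] (d : ℕ) : hardFun F m d (fun _ => 0) = 0 := by
  induction d with
  | zero => exact (hardFun_zero _).trans (by simp)
  | succ d ih =>
    refine (hardFun_succ d _).trans ?_
    rw [Finset.prod_eq_zero (Finset.mem_univ (0 : Fin m))]
    simp [ih]

end Eval

/-! ### The random restriction. -/

/-- The leaves of the tree of copies that are reached through first copies only. -/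
def Leaf (m : ℕ) : ℕ → Type
  | 0 => Fin 4
  | d + 1 => Fin m × Leaf m d

instance instFintypeLeaf (m : ℕ) : ∀ d, Fintype (Leaf m d)
  | 0 => inferInstanceAs (Fintype (Fin 4))
  | d + 1 =>
    letI := instFintypeLeaf m d
    inferInstanceAs (Fintype (Fin m × Leaf m d))

/-- A fixed leaf. -/
def baseLeaf (m : ℕ) [NeZero m] : ∀ d, Leaf m d
  | 0 => (0 : Fin 4)
  | d + 1 => ((0 : Fin m), baseLeaf m d)

instance (m : ℕ) [NeZero m] (d : ℕ) : Nonempty (Leaf m d) := ⟨baseLeaf m d⟩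

/-- The variable at a leaf. -/
def leafVar (m : ℕ) : ∀ d, Leaf m d → Vars m d
  | 0, a => (show Fin 4 from a, (0 : Fin 2))
  | d + 1, l => ((l.1, (0 : Fin 2)), leafVar m d l.2)

/-- The labelling that turns the hard polynomial into the single variable at the leaf `l`,
labelled `c`. -/
def singleLabel (m : ℕ) : ∀ d, Leaf m d → Label → Vars m d → Label
  | 0, l, c, v =>
    if v.1 = (show Fin 4 from l) then (if v.2 = 0 then c else .one)
    else if v.1.val / 2 = (show Fin 4 from l).val / 2 then .zero
    else if v.1.val % 2 = 0 then .one else .zero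
  | d + 1, l, c, v =>
    if v.1.2 = 0 then singleLabel m d l.2 (if v.1.1 = l.1 then c else .one) v.2 else .zero

/-- The label `y` or `z`, according to a sign. -/
def signLabel (s : Bool) : Label := if s then .y else .z

/-- The labelling of a family of blocks, each of which has two copies of a variable set `X`: a
block of type `true` is labelled recursively on the first copy and by zeros on the second copy,
a block of type `false` gets a single free variable in each copy. -/
def blockLabel {B L X W : Type*} (single : L → Label → X → Label) (base : L)
    (rec : W → X → Label) (q : B → Bool × L) (sg : B → Bool) (sub : B → W)
    (v : (B × Fin 2) × X) : Label :=
  if (q v.1.1).1 then (if v.1.2 = 0 then rec (sub v.1.1) v.2 else .zero)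
  else if v.1.2 = 0 then single (q v.1.1).2 (signLabel (sg v.1.1)) v.2
    else single base (signLabel (!sg v.1.1)) v.2

/-- The sample space of the random labellings. -/
def Sample (m : ℕ) : ℕ → Type
  | 0 => Unit
  | d + 1 => (Fin m → Bool × Leaf m d) × (Fin m → Bool) × (Fin m → Sample m d)

instance instFintypeSample (m : ℕ) : ∀ d, Fintype (Sample m d)
  | 0 => inferInstanceAs (Fintype Unit)
  | d + 1 =>
    letI := instFintypeSample m d
    inferInstanceAs
      (Fintype ((Fin m → Bool × Leaf m d) × (Fin m → Bool) × (Fin m → Sample m d)))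

instance instNonemptySample (m : ℕ) [NeZero m] : ∀ d, Nonempty (Sample m d)
  | 0 => inferInstanceAs (Nonempty Unit)
  | d + 1 =>
    letI := instNonemptySample m d
    inferInstanceAs
      (Nonempty ((Fin m → Bool × Leaf m d) × (Fin m → Bool) × (Fin m → Sample m d)))

/-- The random labelling of the variables of the hard polynomial. -/
def sampleLabel (m : ℕ) [NeZero m] : ∀ d, Sample m d → Vars m d → Label
  | 0, _, v => if v.2 = 0 then (if v.1.val % 2 = 0 then .y else .z) else .one
  | d + 1, w, v => blockLabel (singleLabel m d) (baseLeaf m d) (sampleLabel m d) w.1 w.2.1 w.2.2 v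

/-! ### Full rank of the restricted hard polynomial. -/

section Full

variable {F : Type*} [Field F] {m : ℕ}

theorem singleLabel_leafVar (d : ℕ) (l : Leaf m d) (c : Label) :
    singleLabel m d l c (leafVar m d l) = c := by
  induction d generalizing c with
  | zero => exact (if_pos rfl).trans (if_pos rfl)
  | succ d ih => simp [singleLabel, leafVar, ih]

theorem singleLabel_of_ne (d : ℕ) (l : Leaf m d) (c : Label) (v : Vars m d)
    (hv : v ≠ leafVar m d l) :
    singleLabel m d l c v = .zero ∨ singleLabel m d l c v = .one := by
  induction d generalizing c with
  | zero =>
    simp only [singleLabel]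
    split_ifs with h1 h2
    · exact absurd (Prod.ext h1 h2) hv
    all_goals simp
  | succ d ih =>
    obtain ⟨⟨i, j⟩, v⟩ := v
    simp only [singleLabel]
    by_cases hj : j = 0
    · subst hj
      simp only [if_true]
      by_cases hi : i = l.1
      · simp only [hi, if_true]
        refine ih _ _ _ ?_
        rintro rfl
        subst hi
        exact hv rfl
      · simp only [hi, if_false]
        by_cases hv' : v = leafVar m d l.2
        · subst hv'
          rw [singleLabel_leafVar]
          simp
        · exact ih _ _ _ hv'
    · simp [hj]

/-- Used when a sign is flipped: in a collapsed block only the two free variables change their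
labels. -/
theorem singleLabel_congr (d : ℕ) (l : Leaf m d) (c c' : Label) (v : Vars m d)
    (hv : v ≠ leafVar m d l) : singleLabel m d l c v = singleLabel m d l c' v := by
  induction d generalizing c c' with
  | zero =>
    simp only [singleLabel]
    split_ifs with h1 h2
    · exact absurd (Prod.ext h1 h2) hv
    all_goals rfl
  | succ d ih =>
    obtain ⟨⟨i, j⟩, v⟩ := v
    simp only [singleLabel]
    by_cases hj : j = 0
    · subst hj
      simp only [if_true]
      by_cases hi : i = l.1
      · simp only [hi, if_true]
        refine ih _ _ _ _ ?_
        rintro rfl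
        subst hi
        exact hv rfl
      · simp only [hi, if_false]
    · simp [hj]

/-- The value of a label. -/
def labelVal (F : Type*) [Field F] (c : Label) (a b : Bool) : F :=
  match c with
  | .y => if a then 1 else 0
  | .z => if b then -1 else 0
  | .zero => 0
  | .one => 1

theorem labelVal_zero (a b : Bool) : labelVal F .zero a b = 0 := rfl

theorem labelVal_one (a b : Bool) : labelVal F .one a b = 1 := rfl

theorem point_eq {V : Type*} (lab : V → Label) (a b : V → Bool) (v : V) :
    point F lab a b v = labelVal F (lab v) (a v) (b v) := rfl

/-- Second copies vanish, and a factor off the path to `l` is restricted with the label `one` in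
place of `c`, so by induction it equals 1. Only the factor containing the leaf survives. -/
theorem hardFun_single [NeZero m] (d : ℕ) (l : Leaf m d) (c : Label) (a b : Vars m d → Bool) :
    hardFun F m d (point F (singleLabel m d l c) a b) =
      labelVal F c (a (leafVar m d l)) (b (leafVar m d l)) := by
  induction d generalizing c with
  | zero =>
    refine (hardFun_zero _).trans ?_
    have hl : ∀ l : Fin 4, l = 0 ∨ l = 1 ∨ l = 2 ∨ l = 3 := by decide
    simp only [point_eq]
    rcases hl l with rfl | rfl | rfl | rfl <;>
      simp [singleLabel, labelVal_zero, labelVal_one, mk₀] <;> rfl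
  | succ d ih =>
    refine (hardFun_succ d _).trans ?_
    have h1 : ∀ i : Fin m, hardFun F m d
        (fun x => point F (singleLabel m (d + 1) l c) a b (mkSucc i 1 x)) = 0 := by
      intro i
      rw [← hardFun_const_zero (F := F) (m := m) d]
      rfl
    have h0 : ∀ i : Fin m, hardFun F m d
        (fun x => point F (singleLabel m (d + 1) l c) a b (mkSucc i 0 x)) =
        if i = l.1 then labelVal F c (a (leafVar m (d + 1) l)) (b (leafVar m (d + 1) l))
        else 1 := by
      intro i
      refine (ih l.2 (if i = l.1 then c else .one) (fun x => a (mkSucc i 0 x))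
        (fun x => b (mkSucc i 0 x))).trans ?_
      split_ifs with h
      · subst h; rfl
      · rfl
    simp only [h0, h1, add_zero, Finset.prod_ite_eq', Finset.mem_univ, if_true]

/-- Under each random labelling the hard polynomial is a product of sums `y + z`. -/
theorem exists_pairs [NeZero m] (d : ℕ) (w : Sample m d) :
    ∃ (I : Type) (_ : Fintype I) (py pz : I → Vars m d), Function.Injective py ∧
      Function.Injective pz ∧ (∀ i, sampleLabel m d w (py i) = .y) ∧
      (∀ i, sampleLabel m d w (pz i) = .z) ∧
      (∀ v, sampleLabel m d w v = .y → ∃ i, py i = v) ∧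
      (∀ v, sampleLabel m d w v = .z → ∃ i, pz i = v) ∧
      ∀ a b, hardFun F m d (point F (sampleLabel m d w) a b) =
        ∏ i, (point F (sampleLabel m d w) a b (py i) + point F (sampleLabel m d w) a b (pz i)) := by
  induction d with
  | zero =>
    have hcases : ∀ v : Vars m 0, ∃ i j, v = mk₀ i j := fun v => ⟨v.1, v.2, rfl⟩
    refine ⟨Fin 2, inferInstance, ![mk₀ 0 0, mk₀ 2 0], ![mk₀ 1 0, mk₀ 3 0], ?_, ?_, ?_, ?_, ?_,
      ?_, ?_⟩
    · exact Function.LeftInverse.injective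
        (g := fun v : Vars m 0 => if v.1.val < 2 then (0 : Fin 2) else 1)
        (fun i => by fin_cases i <;> rfl)
    · exact Function.LeftInverse.injective
        (g := fun v : Vars m 0 => if v.1.val < 2 then (0 : Fin 2) else 1)
        (fun i => by fin_cases i <;> rfl)
    · intro i; fin_cases i <;> simp [sampleLabel, mk₀]
    · intro i; fin_cases i <;> simp [sampleLabel, mk₀]
    · intro v h
      obtain ⟨i, j, rfl⟩ := hcases v
      fin_cases i <;> fin_cases j <;> simp [sampleLabel, mk₀] at h
      · exact ⟨0, rfl⟩
      · exact ⟨1, rfl⟩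
    · intro v h
      obtain ⟨i, j, rfl⟩ := hcases v
      fin_cases i <;> fin_cases j <;> simp [sampleLabel, mk₀] at h
      · exact ⟨0, rfl⟩
      · exact ⟨1, rfl⟩
    · intro a b
      have h0 : ∀ i, sampleLabel m 0 w (mk₀ i 0) = if i.val % 2 = 0 then .y else .z :=
        fun i => rfl
      have h1 : ∀ i, sampleLabel m 0 w (mk₀ i 1) = .one := fun i => rfl
      simp only [hardFun_zero, point_eq, h0, h1, labelVal_one, mul_one, Fin.prod_univ_two,
        Matrix.cons_val_zero, Matrix.cons_val_one]
  | succ d ih =>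
    obtain ⟨q, sg, sub⟩ := w
    -- Each factor is itself a product of sums over pairs: a single pair when the block is
    -- collapsed, the pairs of the recursive restriction when it is alive. The pairs of the blocks
    -- are then collected in a sigma type.
    have block : ∀ i : Fin m, ∃ (I : Type) (_ : Fintype I) (py pz : I → Fin 2 × Vars m d),
        Function.Injective py ∧ Function.Injective pz ∧
        (∀ k, sampleLabel m (d + 1) (q, sg, sub) (mkSucc i (py k).1 (py k).2) = .y) ∧
        (∀ k, sampleLabel m (d + 1) (q, sg, sub) (mkSucc i (pz k).1 (pz k).2) = .z) ∧
        (∀ j v, sampleLabel m (d + 1) (q, sg, sub) (mkSucc i j v) = .y → ∃ k, py k = (j, v)) ∧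
        (∀ j v, sampleLabel m (d + 1) (q, sg, sub) (mkSucc i j v) = .z → ∃ k, pz k = (j, v)) ∧
        ∀ a b, hardFun F m d (fun x =>
            point F (sampleLabel m (d + 1) (q, sg, sub)) a b (mkSucc i 0 x)) +
          hardFun F m d (fun x =>
            point F (sampleLabel m (d + 1) (q, sg, sub)) a b (mkSucc i 1 x)) =
          ∏ k, (point F (sampleLabel m (d + 1) (q, sg, sub)) a b
              (mkSucc i (py k).1 (py k).2) +
            point F (sampleLabel m (d + 1) (q, sg, sub)) a b (mkSucc i (pz k).1 (pz k).2)) := by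
      intro i
      rcases hq : (q i).1 with _ | _
      · have l0 : ∀ v, sampleLabel m (d + 1) (q, sg, sub) (mkSucc i 0 v) =
            singleLabel m d (q i).2 (signLabel (sg i)) v := by
          intro v; simp [sampleLabel, blockLabel, mkSucc, hq]
        have l1 : ∀ v, sampleLabel m (d + 1) (q, sg, sub) (mkSucc i 1 v) =
            singleLabel m d (baseLeaf m d) (signLabel (!sg i)) v := by
          intro v; simp [sampleLabel, blockLabel, mkSucc, hq]
        have hf : ∀ a b, hardFun F m d (fun x =>
            point F (sampleLabel m (d + 1) (q, sg, sub)) a b (mkSucc i 0 x)) +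
            hardFun F m d (fun x =>
            point F (sampleLabel m (d + 1) (q, sg, sub)) a b (mkSucc i 1 x)) =
            point F (sampleLabel m (d + 1) (q, sg, sub)) a b
              (mkSucc i 0 (leafVar m d (q i).2)) +
            point F (sampleLabel m (d + 1) (q, sg, sub)) a b
              (mkSucc i 1 (leafVar m d (baseLeaf m d))) := by
          intro a b
          have e0 := hardFun_single (F := F) d (q i).2 (signLabel (sg i))
            (fun x => a (mkSucc i 0 x)) (fun x => b (mkSucc i 0 x))
          have e1 := hardFun_single (F := F) d (baseLeaf m d) (signLabel (!sg i))
            (fun x => a (mkSucc i 1 x)) (fun x => b (mkSucc i 1 x))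
          simp only [point_eq, l0, l1, singleLabel_leafVar]
          exact congrArg₂ (· + ·) e0 e1
        have hfree : ∀ (j : Fin 2) v, (sampleLabel m (d + 1) (q, sg, sub) (mkSucc i j v) = .y ∨
            sampleLabel m (d + 1) (q, sg, sub) (mkSucc i j v) = .z) →
            (j = 0 ∧ v = leafVar m d (q i).2) ∨ (j = 1 ∧ v = leafVar m d (baseLeaf m d)) := by
          intro j v h
          by_contra hne
          fin_cases j
          · have hv : v ≠ leafVar m d (q i).2 := fun hv => hne (Or.inl ⟨rfl, hv⟩)
            have := singleLabel_of_ne d _ (signLabel (sg i)) v hv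
            rw [← l0] at this
            rcases this with this | this <;> simp [this] at h
          · have hv : v ≠ leafVar m d (baseLeaf m d) := fun hv => hne (Or.inr ⟨rfl, hv⟩)
            have := singleLabel_of_ne d _ (signLabel (!sg i)) v hv
            rw [← l1] at this
            rcases this with this | this <;> simp [this] at h
        have v0 : sampleLabel m (d + 1) (q, sg, sub) (mkSucc i 0 (leafVar m d (q i).2)) =
            signLabel (sg i) := by rw [l0, singleLabel_leafVar]
        have v1 : sampleLabel m (d + 1) (q, sg, sub) (mkSucc i 1 (leafVar m d (baseLeaf m d))) =
            signLabel (!sg i) := by rw [l1, singleLabel_leafVar]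
        rcases hs : sg i with _ | _
        · rw [hs] at v0 v1
          refine ⟨Unit, inferInstance, fun _ => (1, leafVar m d (baseLeaf m d)),
            fun _ => (0, leafVar m d (q i).2), fun _ _ _ => rfl, fun _ _ _ => rfl,
            fun _ => v1, fun _ => v0, ?_, ?_, ?_⟩
          · intro j v h
            rcases hfree j v (Or.inl h) with ⟨rfl, rfl⟩ | ⟨rfl, rfl⟩
            · rw [v0] at h; simp [signLabel] at h
            · exact ⟨(), rfl⟩
          · intro j v h
            rcases hfree j v (Or.inr h) with ⟨rfl, rfl⟩ | ⟨rfl, rfl⟩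
            · exact ⟨(), rfl⟩
            · rw [v1] at h; simp [signLabel] at h
          · intro a b
            rw [hf, add_comm]; simp
        · rw [hs] at v0 v1
          refine ⟨Unit, inferInstance, fun _ => (0, leafVar m d (q i).2),
            fun _ => (1, leafVar m d (baseLeaf m d)), fun _ _ _ => rfl, fun _ _ _ => rfl,
            fun _ => v0, fun _ => v1, ?_, ?_, ?_⟩
          · intro j v h
            rcases hfree j v (Or.inl h) with ⟨rfl, rfl⟩ | ⟨rfl, rfl⟩
            · exact ⟨(), rfl⟩
            · rw [v1] at h; simp [signLabel] at h
          · intro j v h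
            rcases hfree j v (Or.inr h) with ⟨rfl, rfl⟩ | ⟨rfl, rfl⟩
            · rw [v0] at h; simp [signLabel] at h
            · exact ⟨(), rfl⟩
          · intro a b
            rw [hf]; simp
      · have l0 : ∀ v, sampleLabel m (d + 1) (q, sg, sub) (mkSucc i 0 v) =
            sampleLabel m d (sub i) v := by
          intro v; simp [sampleLabel, blockLabel, mkSucc, hq]
        have l1 : ∀ v, sampleLabel m (d + 1) (q, sg, sub) (mkSucc i 1 v) = .zero := by
          intro v; simp [sampleLabel, blockLabel, mkSucc, hq]
        obtain ⟨I, hI, py, pz, ipy, ipz, ly, lz, cy, cz, hprod⟩ := ih (sub i)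
        refine ⟨I, hI, fun k => (0, py k), fun k => (0, pz k), fun k k' h => ipy (by simpa using h),
          fun k k' h => ipz (by simpa using h), fun k => (l0 _).trans (ly k),
          fun k => (l0 _).trans (lz k), ?_, ?_, ?_⟩
        · intro j v h
          fin_cases j
          · obtain ⟨k, hk⟩ := cy v ((l0 v).symm.trans h)
            exact ⟨k, by subst hk; rfl⟩
          · exact absurd ((l1 v).symm.trans h) (by simp)
        · intro j v h
          fin_cases j
          · obtain ⟨k, hk⟩ := cz v ((l0 v).symm.trans h)
            exact ⟨k, by subst hk; rfl⟩
          · exact absurd ((l1 v).symm.trans h) (by simp)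
        · intro a b
          have e := hprod (fun x => a (mkSucc i 0 x)) (fun x => b (mkSucc i 0 x))
          have z := hardFun_const_zero (F := F) (m := m) d
          simp only [point_eq, l0, l1, labelVal_zero, z, add_zero]
          exact e
    choose I hI py pz ipy ipz ly lz cy cz hprod using block
    refine ⟨Σ i, I i, inferInstance, fun k => mkSucc k.1 (py k.1 k.2).1 (py k.1 k.2).2,
      fun k => mkSucc k.1 (pz k.1 k.2).1 (pz k.1 k.2).2, ?_, ?_, fun k => ly k.1 k.2,
      fun k => lz k.1 k.2, ?_, ?_, ?_⟩
    · rintro ⟨i, k⟩ ⟨i', k'⟩ h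
      obtain rfl : i = i' := congrArg (fun v : (Fin m × Fin 2) × Vars m d => v.1.1) h
      have h1 : py i k = py i k' :=
        congrArg (fun v : (Fin m × Fin 2) × Vars m d => (v.1.2, v.2)) h
      rw [ipy i h1]
    · rintro ⟨i, k⟩ ⟨i', k'⟩ h
      obtain rfl : i = i' := congrArg (fun v : (Fin m × Fin 2) × Vars m d => v.1.1) h
      have h1 : pz i k = pz i k' :=
        congrArg (fun v : (Fin m × Fin 2) × Vars m d => (v.1.2, v.2)) h
      rw [ipz i h1]
    · rintro ⟨⟨i, j⟩, v⟩ h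
      obtain ⟨k, hk⟩ := cy i j v h
      exact ⟨⟨i, k⟩, by simp only [hk]; rfl⟩
    · rintro ⟨⟨i, j⟩, v⟩ h
      obtain ⟨k, hk⟩ := cz i j v h
      exact ⟨⟨i, k⟩, by simp only [hk]; rfl⟩
    · intro a b
      rw [hardFun_succ, Fintype.prod_sigma]
      exact Finset.prod_congr rfl fun i _ => hprod i a b

/-- The hard polynomial has full rank under every random labelling. -/
theorem one_le_relrk_hardFun [NeZero m] (d : ℕ) (w : Sample m d) :
    1 ≤ relrk (sampleLabel m d w) univ (hardFun F m d) := by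
  obtain ⟨I, hI, py, pz, ipy, ipz, ly, lz, cy, cz, hprod⟩ := exists_pairs (F := F) d w
  have h1 : (2 : ℝ) ^ Fintype.card I ≤ rk (sampleLabel m d w) (hardFun F m d) := by
    exact_mod_cast two_pow_le_rk py pz ipy ipz ly lz hprod
  have h2 : ∀ (c : Label) (p : I → Vars m d), (∀ v, sampleLabel m d w v = c → ∃ i, p i = v) →
      #{v ∈ univ | sampleLabel m d w v = c} ≤ Fintype.card I := by
    intro c p hp
    refine (Finset.card_le_card (t := univ.image p) fun v hv => ?_).trans Finset.card_image_le
    obtain ⟨i, hi⟩ := hp v (by simpa using hv)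
    exact Finset.mem_image.2 ⟨i, Finset.mem_univ _, hi⟩
  have h3 : free (sampleLabel m d w) univ ≤ Fintype.card I + Fintype.card I :=
    Nat.add_le_add (h2 _ py cy) (h2 _ pz cz)
  calc (1 : ℝ) = 2 ^ Fintype.card I * theta ^ (Fintype.card I + (Fintype.card I + 0)) := by
        rw [two_pow_mul_theta_pow, pow_zero]
    _ ≤ rk (sampleLabel m d w) (hardFun F m d) * theta ^ free (sampleLabel m d w) univ :=
        mul_le_mul h1 (pow_le_pow_of_le_one theta_pos.le (theta_le.trans (by norm_num)) h3)
          (pow_nonneg theta_pos.le _) (Nat.cast_nonneg _)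

end Full

/-! ### Iterated sums of products over disjoint variable sets. -/

section Comp

variable {F : Type*} [Field F] {V : Type*}

/-- Functions of the variables `S` computed by set-multilinear sums of products: affine functions
for `d = 0`, and for larger `d` sums of at most `s` products of functions of smaller depth that
depend on disjoint sets of variables. -/
def Comp (s : ℕ) : ℕ → Finset V → ((V → F) → F) → Prop
  | 0, S, h => ∃ (c₀ : F) (c : V → F), ∀ x, h x = c₀ + ∑ v ∈ S, c v * x v
  | d + 1, S, h => ∃ (n : Fin s → ℕ) (c : Fin s → F) (T : ∀ t, Fin (n t) → Finset V)
      (g : ∀ t, Fin (n t) → (V → F) → F),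
      (∀ t l, T t l ⊆ S) ∧ (∀ t, Pairwise (Function.onFun Disjoint (T t))) ∧
      (∀ t l, Comp s d (T t l) (g t l)) ∧ ∀ x, h x = ∑ t, c t * ∏ l, g t l x

theorem Comp.dependsOn {s d : ℕ} {S : Finset V} {h : (V → F) → F} (H : Comp s d S h) :
    DependsOn h (S : Set V) := by
  induction d generalizing S h with
  | zero =>
    obtain ⟨c₀, c, hh⟩ := H
    intro x y hxy
    rw [hh, hh]
    congr 1
    exact Finset.sum_congr rfl fun v hv => by rw [hxy v hv]
  | succ d ih =>
    obtain ⟨n, c, T, g, hT, -, hg, hh⟩ := H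
    intro x y hxy
    rw [hh, hh]
    refine Finset.sum_congr rfl fun t _ => congrArg _ (Finset.prod_congr rfl fun l _ => ?_)
    exact ih (hg t l) fun v hv => hxy v (hT t l hv)

theorem Comp.one {s : ℕ} (hs : 0 < s) (d : ℕ) (S : Finset V) :
    Comp (F := F) s d S (fun _ => 1) := by
  cases d with
  | zero => exact ⟨1, fun _ => 0, by simp⟩
  | succ d =>
    -- The constant 1 is an empty product with coefficient 1 in the first slot and 0 in the others;
    -- `hs` provides the slot.
    refine ⟨fun _ => 0, fun t => if t = ⟨0, hs⟩ then 1 else 0, fun _ _ => ∅, fun _ _ _ => 0,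
      fun t l => l.elim0, fun t l => l.elim0, fun t l => l.elim0, fun x => ?_⟩
    simp

/-- The products in a sum of products can be made to cover all variables. -/
theorem Comp.exists_cover [DecidableEq V] {s d : ℕ} (hs : 0 < s) {S : Finset V}
    {h : (V → F) → F} (H : Comp s (d + 1) S h) :
    ∃ (n : Fin s → ℕ) (c : Fin s → F) (T : ∀ t, Option (Fin (n t)) → Finset V)
      (g : ∀ t, Option (Fin (n t)) → (V → F) → F),
      (∀ t, univ.biUnion (T t) = S) ∧ (∀ t, Pairwise (Function.onFun Disjoint (T t))) ∧
      (∀ t l, Comp s d (T t l) (g t l)) ∧ ∀ x, h x = ∑ t, c t * ∏ l, g t l x := by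
  obtain ⟨n, c, T, g, hT, hd, hg, hh⟩ := H
  -- The uncovered variables go to an extra factor 1. The factors of `relrk` multiply correctly only
  -- when the parts partition `S`.
  refine ⟨n, c, fun t l => l.elim (S \ univ.biUnion (T t)) (T t), fun t l => l.elim (fun _ => 1)
    (g t), fun t => ?_, fun t => ?_, fun t l => ?_, fun x => ?_⟩
  · ext v
    simp only [mem_biUnion, mem_univ, true_and]
    constructor
    · rintro ⟨_ | l, hl⟩
      · exact (Finset.mem_sdiff.1 hl).1
      · exact hT t l hl
    · intro hv
      by_cases h : ∃ l, v ∈ T t l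
      · obtain ⟨l, hl⟩ := h
        exact ⟨some l, hl⟩
      · exact ⟨none, by simpa [hv] using h⟩
  · have key : ∀ l, Disjoint (S \ univ.biUnion (T t)) (T t l) := fun l =>
      Finset.disjoint_left.2 fun v hv hv' =>
        (Finset.mem_sdiff.1 hv).2 (Finset.mem_biUnion.2 ⟨l, mem_univ _, hv'⟩)
    rintro (_ | l) (_ | l') hne
    · exact absurd rfl hne
    · exact key l'
    · exact (key l).symm
    · exact hd t fun h => hne (congrArg some h)
  · cases l with
    | none => exact Comp.one hs d _
    | some l => exact hg t l
  · simp [hh]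

end Comp

/-! ### From multilinear circuits to sums of products. -/

section Circuits

variable {F : Type*} [Field F] {σ : Type*}

open MvPolynomial

/-- Every gate is a linear combination of the input gates and product gates below it. -/
theorem gatePoly_eq_sum (C : Circuit F σ) (i : Fin C.size) :
    ∃ c : Fin C.size → F, C.gatePoly i = ∑ u, MvPolynomial.C (c u) * C.gatePoly u ∧
      ∀ u, c u ≠ 0 → C.gateProductDepth u ≤ C.gateProductDepth i ∧
        ∀ d a ch, C.gate u ≠ .sum d a ch := by
  obtain ⟨i, hi⟩ := i
  induction i using Nat.strong_induction_on with
  | _ i ih =>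
    by_cases hsum : ∃ d a ch, C.gate ⟨i, hi⟩ = .sum d a ch
    · obtain ⟨d, a, ch, hg⟩ := hsum
      choose c hc1 hc2 using fun t : Fin d => ih (ch t) (ch t).isLt ((ch t).isLt.trans hi)
      refine ⟨fun u => ∑ t, a t * c t u, ?_, fun u hu => ?_⟩
      · rw [Circuit.gatePoly, hg]
        simp only [hc1, map_sum, _root_.map_mul, Finset.sum_mul, Finset.mul_sum, mul_assoc]
        rw [Finset.sum_comm]
      · obtain ⟨t, -, ht⟩ := Finset.exists_ne_zero_of_sum_ne_zero hu
        obtain ⟨h1, h2⟩ := hc2 t u (right_ne_zero_of_mul ht)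
        refine ⟨h1.trans ?_, h2⟩
        conv_rhs => rw [Circuit.gateProductDepth, hg]
        exact Finset.le_sup (f := fun t => C.gateProductDepth ⟨ch t, (ch t).isLt.trans hi⟩)
          (Finset.mem_univ t)
    · refine ⟨fun u => if u = ⟨i, hi⟩ then 1 else 0, ?_, fun u hu => ?_⟩
      · simp
      · by_cases h : u = ⟨i, hi⟩
        · subst h
          exact ⟨le_rfl, fun d a ch hg => hsum ⟨d, a, ch, hg⟩⟩
        · simp [h] at hu

variable {V : Type*} [DecidableEq V]

open Classical in
/-- The assignment of the variables `σ` that sets all variables outside `e '' A` to zero. -/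
noncomputable def extendPoint (e : V → σ) (A : Finset V) (x : V → F) : σ → F :=
  Function.extend e (fun v => if v ∈ A then x v else 0) 0

theorem extendPoint_eq_sum [Fintype V] (e : V ↪ σ) (A : Finset V) (s : σ) :
    ∃ c : V → F, ∀ x : V → F, extendPoint e A x s = ∑ v ∈ A, c v * x v := by
  classical
  by_cases h : ∃ v ∈ A, e v = s
  · obtain ⟨v, hv, rfl⟩ := h
    refine ⟨fun w => if w = v then 1 else 0, fun x => ?_⟩
    simp [extendPoint, e.injective.extend_apply, hv]
  · refine ⟨fun _ => 0, fun x => ?_⟩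
    by_cases h' : ∃ v, e v = s
    · obtain ⟨v, rfl⟩ := h'
      have hv : v ∉ A := fun hv => h ⟨v, hv, rfl⟩
      simp [extendPoint, e.injective.extend_apply, hv]
    · simp [extendPoint, Function.extend_apply' _ _ _ h']

open Classical in
theorem eval_extendPoint_congr (e : V ↪ σ) (A : Finset V) (p : MvPolynomial σ F)
    (x : V → F) :
    eval (extendPoint e A x) p = eval (extendPoint e {v ∈ A | e v ∈ p.vars} x) p := by
  refine eval₂Hom_congr' rfl (fun i hi _ => ?_) rfl
  by_cases h' : ∃ v, e v = i
  · obtain ⟨v, rfl⟩ := h'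
    simp [extendPoint, e.injective.extend_apply, hi]
  · simp [extendPoint, Function.extend_apply' _ _ _ h']

/-- Degrees in a variable add up over a domain, so a shared variable would have degree at least 2 in
the product. -/
theorem disjoint_vars_of_prod {ι : Type*} [Fintype ι] {f : ι → MvPolynomial σ F}
    (hf : ∀ i, f i ≠ 0) (hml : ∀ x, (∏ i, f i).degreeOf x ≤ 1) {i j : ι} (hij : i ≠ j) {x : σ}
    (hi : x ∈ (f i).vars) (hj : x ∈ (f j).vars) : False := by
  classical
  have h := hml x
  rw [degreeOf_prod_eq _ _ fun i _ => hf i] at h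
  have h2 : ∑ k ∈ {i, j}, degreeOf x (f k) ≤ 1 :=
    (Finset.sum_le_sum_of_subset (Finset.subset_univ _)).trans h
  rw [Finset.sum_pair hij] at h2
  have := mem_vars_iff_degreeOf_ne_zero.1 hi
  have := mem_vars_iff_degreeOf_ne_zero.1 hj
  omega

/-- Collapsing sum gates leaves at most one term per gate, hence the bound `C.size` at every level.
The set `A` is arbitrary so that the induction can restrict each factor to its own variables;
setting everything outside to zero also removes the foreign variables of `σ`. -/
theorem comp_gatePoly [Fintype V] (C : Circuit F σ) (hC : C.IsMultilinear) (e : V ↪ σ) (d : ℕ)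
    (i : Fin C.size) (A : Finset V) (hd : C.gateProductDepth i ≤ d) :
    Comp C.size d A (fun x => eval (extendPoint e A x) (C.gatePoly i)) := by
  classical
  induction d generalizing i A with
  | zero =>
    obtain ⟨c, hc1, hc2⟩ := gatePoly_eq_sum C i
    have haff : ∀ u, ∃ (b₀ : F) (b : V → F), ∀ x : V → F,
        c u * eval (extendPoint e A x) (C.gatePoly u) = b₀ + ∑ v ∈ A, b v * x v := by
      intro u
      by_cases hcu : c u = 0
      · exact ⟨0, fun _ => 0, by simp [hcu]⟩
      obtain ⟨h1, h2⟩ := hc2 u hcu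
      have h0 : C.gateProductDepth u = 0 := by omega
      rw [Circuit.gatePoly]
      rw [Circuit.gateProductDepth] at h0
      rcases hg : C.gate u with x | a | ⟨n, a, ch⟩ | ⟨n, a, ch⟩
      · obtain ⟨b, hb⟩ := extendPoint_eq_sum (F := F) e A x
        refine ⟨0, fun v => c u * b v, fun y => ?_⟩
        simp [hb, Finset.mul_sum, mul_assoc]
      · exact ⟨c u * a, fun _ => 0, by simp⟩
      · exact absurd hg (h2 _ _ _)
      · rw [hg] at h0
        simp at h0
    choose b₀ b hb using haff
    refine ⟨∑ u, b₀ u, fun v => ∑ u, b u v, fun x => ?_⟩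
    simp only [hc1, map_sum, _root_.map_mul, eval_C, hb, Finset.sum_add_distrib, Finset.sum_mul]
    rw [Finset.sum_comm]
  | succ d ih =>
    obtain ⟨c, hc1, hc2⟩ := gatePoly_eq_sum C i
    have hterm : ∀ u, ∃ (n : ℕ) (b : F) (T : Fin n → Finset V) (g : Fin n → (V → F) → F),
        (∀ l, T l ⊆ A) ∧ Pairwise (Function.onFun Disjoint T) ∧
        (∀ l, Comp C.size d (T l) (g l)) ∧
        ∀ x, c u * eval (extendPoint e A x) (C.gatePoly u) = b * ∏ l, g l x := by
      intro u
      have trivial_term : (∀ x, c u * eval (extendPoint e A x) (C.gatePoly u) = 0) →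
          ∃ (n : ℕ) (b : F) (T : Fin n → Finset V) (g : Fin n → (V → F) → F),
          (∀ l, T l ⊆ A) ∧ Pairwise (Function.onFun Disjoint T) ∧
          (∀ l, Comp C.size d (T l) (g l)) ∧
          ∀ x, c u * eval (extendPoint e A x) (C.gatePoly u) = b * ∏ l, g l x := fun h =>
        ⟨0, 0, fun _ => ∅, fun _ _ => 0, fun l => l.elim0, fun l => l.elim0, fun l => l.elim0,
          fun x => by rw [h x]; simp⟩
      by_cases hcu : c u = 0
      · exact trivial_term fun x => by simp [hcu]
      -- The degree argument for disjointness needs all factors nonzero, so vanishing gates are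
      -- treated apart.
      by_cases hu0 : C.gatePoly u = 0
      · exact trivial_term fun x => by simp [hu0]
      obtain ⟨h1, h2⟩ := hc2 u hcu
      -- A gate that is already shallow enough counts as a product with one factor.
      by_cases hud : C.gateProductDepth u ≤ d
      · exact ⟨1, c u, fun _ => A, fun _ x => eval (extendPoint e A x) (C.gatePoly u),
          fun _ => subset_rfl, fun l l' h => absurd (Subsingleton.elim l l') h,
          fun _ => ih u A hud, fun x => by simp⟩
      have h1' := h1.trans hd
      have hpoly : C.gatePoly u = C.gatePoly u := rfl
      rw [Circuit.gateProductDepth] at h1' hud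
      conv_rhs at hpoly => rw [Circuit.gatePoly]
      rcases hg : C.gate u with x | a | ⟨n, a, ch⟩ | ⟨n, a, ch⟩
      · rw [hg] at hud; simp at hud
      · rw [hg] at hud; simp at hud
      · exact absurd hg (h2 _ _ _)
      · rw [hg] at h1' hpoly
        simp only at h1' hpoly
        let ch' : Fin n → Fin C.size := fun t => ⟨ch t, (ch t).isLt.trans u.isLt⟩
        have hne : ∀ t, MvPolynomial.C (a t) * C.gatePoly (ch' t) ≠ 0 := by
          intro t ht
          exact hu0 (hpoly.trans (Finset.prod_eq_zero (Finset.mem_univ t) ht))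
        have hvars : ∀ t, (C.gatePoly (ch' t)).vars ⊆
            (MvPolynomial.C (a t) * C.gatePoly (ch' t)).vars := by
          intro t x hx
          rw [mem_vars_iff_degreeOf_ne_zero] at hx ⊢
          rwa [degreeOf_mul_eq (left_ne_zero_of_mul (hne t)) (right_ne_zero_of_mul (hne t)),
            degreeOf_C, zero_add]
        have hml : ∀ x, (∏ t, (MvPolynomial.C (a t) * C.gatePoly (ch' t))).degreeOf x ≤ 1 :=
          fun x => hpoly ▸ hC u x
        have hdep : ∀ t, C.gateProductDepth (ch' t) ≤ d := by
          intro t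
          have := Finset.le_sup (f := fun t => C.gateProductDepth (ch' t)) (Finset.mem_univ t)
          have : C.gateProductDepth (ch' t) ≤ _ := this
          change 1 + Finset.univ.sup (fun t => C.gateProductDepth (ch' t)) ≤ d + 1 at h1'
          omega
        refine ⟨n, c u * ∏ t, a t, fun t => {v ∈ A | e v ∈ (C.gatePoly (ch' t)).vars},
          fun t x => eval (extendPoint e {v ∈ A | e v ∈ (C.gatePoly (ch' t)).vars} x)
            (C.gatePoly (ch' t)), fun t => Finset.filter_subset _ _, fun t t' htt => ?_,
          fun t => ih (ch' t) _ (hdep t), fun x => ?_⟩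
        · refine Finset.disjoint_left.2 fun v hv hv' => ?_
          exact disjoint_vars_of_prod hne hml htt (hvars t (Finset.mem_filter.1 hv).2)
            (hvars t' (Finset.mem_filter.1 hv').2)
        · rw [hpoly, _root_.map_prod]
          simp only [_root_.map_mul, eval_C, Finset.prod_mul_distrib, mul_assoc]
          congr 2
          exact Finset.prod_congr rfl fun t _ => eval_extendPoint_congr e A _ x
    choose n b T g hT hd' hg hh using hterm
    refine ⟨n, b, T, g, hT, hd', hg, fun x => ?_⟩
    simp only [hc1, map_sum, _root_.map_mul, eval_C, hh]

/-- A function computed by a multilinear circuit of product-depth at most `d`. -/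
theorem comp_of_computes [Fintype V] (C : Circuit F σ) (hC : C.IsMultilinear) (e : V ↪ σ)
    (p : MvPolynomial V F) (hp : C.Computes (rename e p)) (d : ℕ) (hd : C.productDepth ≤ d) :
    Comp C.size d univ (fun x => eval x p) := by
  have h := comp_gatePoly C hC e d C.output univ hd
  have hp' : C.gatePoly C.output = rename e p := hp
  convert h using 2 with x
  rw [hp', eval_rename]
  congr 2
  funext v
  simp [extendPoint, e.injective.extend_apply]

end Circuits

/-! ### Averages and a combinatorial selection lemma. -/

section Expectation

theorem expect_pi_prod {B Q : Type*} [Fintype B] [DecidableEq B] [Fintype Q] (f : B → Q → ℝ) :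
    𝔼 q : B → Q, ∏ β, f β (q β) = ∏ β, 𝔼 x, f β x := by
  simp only [Fintype.expect_eq_sum_div_card, Finset.prod_div_distrib, Finset.prod_univ_sum,
    Fintype.piFinset_univ, Finset.prod_const, Fintype.card_fun, Finset.card_univ, Nat.cast_pow]

theorem expect_prod_type {A B : Type*} [Fintype A] [Fintype B] (f : A × B → ℝ) :
    𝔼 x, f x = 𝔼 a, 𝔼 b, f (a, b) := by
  rw [← Finset.univ_product_univ, Finset.expect_product]

theorem expect_mono {A : Type*} [Fintype A] {f g : A → ℝ} (h : ∀ a, f a ≤ g a) :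
    𝔼 a, f a ≤ 𝔼 a, g a := Finset.expect_le_expect fun a _ => h a

theorem expect_le_of_le {A : Type*} [Fintype A] [Nonempty A] {f : A → ℝ} {c : ℝ}
    (h : ∀ a, f a ≤ c) : 𝔼 a, f a ≤ c :=
  (expect_mono h).trans (Fintype.expect_const c).le

/-- Random choices that are independently flipped by the involutions `φ l`. -/
theorem expect_prod_le_pow {Ω τ : Type*} [Fintype Ω] [Nonempty Ω] [DecidableEq τ] {r : ℝ}
    (hr : 0 ≤ r) (A : Finset τ) (φ : τ → Equiv.Perm Ω) (f : τ → Ω → ℝ) (hf0 : ∀ l ω, 0 ≤ f l ω)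
    (hf : ∀ l ∈ A, ∀ ω, f l ω + f l (φ l ω) ≤ 2 * r)
    (hinv : ∀ l ∈ A, ∀ l' ∈ A, l ≠ l' → ∀ ω, f l' (φ l ω) = f l' ω) :
    𝔼 ω, ∏ l ∈ A, f l ω ≤ r ^ #A := by
  induction A using Finset.induction_on with
  | empty => simp
  | insert l A hl ih =>
    have ih' := ih (fun k hk => hf k (mem_insert_of_mem hk)) fun k hk k' hk' =>
      hinv k (mem_insert_of_mem hk) k' (mem_insert_of_mem hk')
    have hG : ∀ ω, ∏ k ∈ A, f k (φ l ω) = ∏ k ∈ A, f k ω := fun ω =>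
      Finset.prod_congr rfl fun k hk => hinv l (mem_insert_self _ _) k (mem_insert_of_mem hk)
        (by rintro rfl; exact hl hk) ω
    -- The remaining product is invariant under `φ l`, so `f l` may be replaced by its average over
    -- the pair `ω`, `φ l ω`, which is at most `r`.
    have h2 : 𝔼 ω, f l (φ l ω) * ∏ k ∈ A, f k ω = 𝔼 ω, f l ω * ∏ k ∈ A, f k ω :=
      Fintype.expect_equiv (φ l) _ _ fun ω => by rw [hG]
    have h3 : 2 * 𝔼 ω, f l ω * ∏ k ∈ A, f k ω ≤ 2 * (r * 𝔼 ω, ∏ k ∈ A, f k ω) := by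
      calc 2 * 𝔼 ω, f l ω * ∏ k ∈ A, f k ω
          = 𝔼 ω, (f l ω + f l (φ l ω)) * ∏ k ∈ A, f k ω := by
            simp only [add_mul, Finset.expect_add_distrib, h2]; ring
        _ ≤ 𝔼 ω, (2 * r) * ∏ k ∈ A, f k ω := expect_mono fun ω =>
            mul_le_mul_of_nonneg_right (hf l (mem_insert_self _ _) ω)
              (Finset.prod_nonneg fun k _ => hf0 k ω)
        _ = _ := by rw [← Finset.mul_expect]; ring
    simp only [Finset.prod_insert hl, Finset.card_insert_of_notMem hl, pow_succ']
    nlinarith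

/-- All out-degrees are at most 1, so some vertex also has in-degree at most 1. Choosing it and
discarding its at most two neighbours costs three vertices per choice. -/
theorem exists_indep {τ : Type*} [DecidableEq τ] (R : τ → τ → Prop) [DecidableRel R]
    (N : Finset τ) (hR : ∀ l ∈ N, #{l' ∈ N | R l l'} ≤ 1) :
    ∃ W ⊆ N, #N ≤ 3 * #W ∧ ∀ l ∈ W, ∀ l' ∈ W, l ≠ l' → ¬ R l l' := by
  induction N using Finset.strongInduction with
  | H N ih =>
    rcases N.eq_empty_or_nonempty with rfl | hN
    · exact ⟨∅, by simp⟩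
    obtain ⟨v, hv, hin⟩ : ∃ v ∈ N, #{l ∈ N | R l v} ≤ 1 := by
      have h := Finset.sum_card_bipartiteAbove_eq_sum_card_bipartiteBelow (s := N) (t := N) R
      refine Finset.exists_le_of_sum_le (f := fun v => #{l ∈ N | R l v}) (g := fun _ => 1) hN ?_
      refine le_trans (le_of_eq h.symm) (Finset.sum_le_sum hR)
    let D : Finset τ := insert v ({l ∈ N | R l v} ∪ {l' ∈ N | R v l'})
    have hD : #D ≤ 3 := by
      refine (Finset.card_insert_le _ _).trans ?_
      have := Finset.card_union_le {l ∈ N | R l v} {l' ∈ N | R v l'}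
      have := hR v hv
      omega
    have hsub : N \ D ⊂ N :=
      Finset.sdiff_subset.ssubset_of_mem_notMem hv fun h =>
        (Finset.mem_sdiff.1 h).2 (Finset.mem_insert_self _ _)
    obtain ⟨W, hW, hcard, hind⟩ := ih (N \ D) hsub fun l hl =>
      (Finset.card_le_card (Finset.filter_subset_filter _ Finset.sdiff_subset)).trans
        (hR l (Finset.mem_sdiff.1 hl).1)
    have hvW : v ∉ W := fun h => (Finset.mem_sdiff.1 (hW h)).2 (Finset.mem_insert_self _ _)
    have hnot : ∀ l ∈ W, ¬ R l v ∧ ¬ R v l := fun l hl => by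
      obtain ⟨h1, h2⟩ := Finset.mem_sdiff.1 (hW hl)
      constructor
      · exact fun h => h2 (Finset.mem_insert_of_mem
          (Finset.mem_union_left _ (Finset.mem_filter.2 ⟨h1, h⟩)))
      · exact fun h => h2 (Finset.mem_insert_of_mem
          (Finset.mem_union_right _ (Finset.mem_filter.2 ⟨h1, h⟩)))
    refine ⟨insert v W, ?_, ?_, ?_⟩
    · exact Finset.insert_subset hv (hW.trans Finset.sdiff_subset)
    · rw [Finset.card_insert_of_notMem hvW]
      have := Finset.le_card_sdiff D N
      omega
    · intro l h l' h' hne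
      rcases Finset.mem_insert.1 h with rfl | hl <;> rcases Finset.mem_insert.1 h' with rfl | hl'
      · exact absurd rfl hne
      · exact (hnot l' hl').2
      · exact (hnot l hl).1
      · exact hind l hl l' hl' hne

end Expectation

/-! ### Crossed parts and random signs. -/

section Crossing

variable {B L τ V : Type*} [Fintype B] [DecidableEq B] [Fintype L] [Fintype τ] [DecidableEq τ]
  [Fintype V] [DecidableEq V]

/-- The part `l` contains exactly one of the two free variables of the block `β`, when the block
is of type `false`. -/
def Crossed (vy : B → L → V) (vz : B → V) (T : τ → Finset V) (l : τ) (β : B)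
    (x : Bool × L) : Prop :=
  x.1 = false ∧ ¬ (vy β x.2 ∈ T l ↔ vz β ∈ T l)

open Classical in
/-- The parts that are crossed by some block. -/
noncomputable def touched (vy : B → L → V) (vz : B → V) (T : τ → Finset V)
    (q : B → Bool × L) : Finset τ := {l | ∃ β, Crossed vy vz T l β (q β)}

-- If at most `M` parts are touched, all of them lie in a set `W` of at most `M` parts, and no block
-- crosses a part outside `W`. Blocks are independent, so for fixed `W` this has probability at most
-- ∏(1 - p_β) ≤ exp(-∑ p_β). Touched parts are nonempty and disjoint, so `W` can be named by `M`
-- variables, and |V|^M choices suffice however many parts there are.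
open Classical in
theorem expect_card_touched_le [Nonempty L] [Nonempty V] (vy : B → L → V) (vz : B → V)
    (T : τ → Finset V) (hT : Pairwise (Function.onFun Disjoint T)) (M : ℕ) (E : ℝ)
    (hE : ∀ W : Finset τ, #W ≤ M →
      E ≤ ∑ β, 𝔼 x : Bool × L, if ∃ l ∉ W, Crossed vy vz T l β x then (1 : ℝ) else 0) :
    𝔼 q : B → Bool × L, (if #(touched vy vz T q) ≤ M then (1 : ℝ) else 0) ≤
      (Fintype.card V : ℝ) ^ M * Real.exp (-E) := by
  let W : (Fin M → V) → Finset τ := fun φ => {l | ∃ j, φ j ∈ T l}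
  have hW : ∀ φ, #(W φ) ≤ M := by
    intro φ
    calc #(W φ) ≤ #(univ.biUnion fun j : Fin M => ({l | φ j ∈ T l} : Finset τ)) := by
          refine Finset.card_le_card fun l hl => ?_
          simpa [W] using hl
      _ ≤ ∑ j : Fin M, #({l | φ j ∈ T l} : Finset τ) := Finset.card_biUnion_le
      _ ≤ ∑ j : Fin M, 1 := by
          refine Finset.sum_le_sum fun j _ => Finset.card_le_one.2 fun l hl l' hl' => ?_
          by_contra hne
          exact Finset.disjoint_left.1 (hT hne) (Finset.mem_filter.1 hl).2
            (Finset.mem_filter.1 hl').2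
      _ = M := by simp
  have hcover : ∀ q : B → Bool × L, #(touched vy vz T q) ≤ M →
      ∃ φ : Fin M → V, touched vy vz T q ⊆ W φ := by
    intro q hq
    have hv : ∀ l : touched vy vz T q, ∃ v, v ∈ T l := by
      rintro ⟨l, hl⟩
      obtain ⟨β, -, hβ⟩ := (Finset.mem_filter.1 hl).2
      by_cases h : vy β (q β).2 ∈ T l
      · exact ⟨_, h⟩
      · exact ⟨vz β, by tauto⟩
    choose v hv using hv
    refine ⟨fun j => if h : j.val < #(touched vy vz T q) then
      v ((touched vy vz T q).equivFin.symm ⟨j, h⟩) else Classical.arbitrary V, fun l hl => ?_⟩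
    refine Finset.mem_filter.2 ⟨mem_univ _,
      Fin.castLE hq ((touched vy vz T q).equivFin ⟨l, hl⟩), ?_⟩
    simpa using hv ⟨l, hl⟩
  calc 𝔼 q : B → Bool × L, (if #(touched vy vz T q) ≤ M then (1 : ℝ) else 0)
      ≤ 𝔼 q : B → Bool × L, ∑ φ : Fin M → V, ∏ β,
          (if ∃ l ∉ W φ, Crossed vy vz T l β (q β) then (0 : ℝ) else 1) := by
        refine expect_mono fun q => ?_
        have h0 : ∀ φ : Fin M → V, 0 ≤ ∏ β,
            (if ∃ l ∉ W φ, Crossed vy vz T l β (q β) then (0 : ℝ) else 1) := fun φ =>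
          Finset.prod_nonneg fun β _ => by split_ifs <;> norm_num
        split_ifs with h
        · obtain ⟨φ, hφ⟩ := hcover q h
          refine le_trans (le_of_eq ?_) (Finset.single_le_sum (fun φ _ => h0 φ) (mem_univ φ))
          refine (Finset.prod_eq_one fun β _ => if_neg ?_).symm
          rintro ⟨l, hl, hc⟩
          exact hl (hφ (Finset.mem_filter.2 ⟨mem_univ _, β, hc⟩))
        · exact Finset.sum_nonneg fun φ _ => h0 φ
    _ = ∑ φ : Fin M → V, ∏ β, 𝔼 x : Bool × L,
          (if ∃ l ∉ W φ, Crossed vy vz T l β x then (0 : ℝ) else 1) := by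
        rw [Finset.expect_sum_comm]
        refine Finset.sum_congr rfl fun φ _ => ?_
        exact expect_pi_prod (fun β x => if ∃ l ∉ W φ, Crossed vy vz T l β x then (0 : ℝ) else 1)
    _ ≤ ∑ φ : Fin M → V, Real.exp (-E) := by
        refine Finset.sum_le_sum fun φ _ => ?_
        have h1 : ∀ β, 𝔼 x : Bool × L,
            (if ∃ l ∉ W φ, Crossed vy vz T l β x then (0 : ℝ) else 1) =
            1 - 𝔼 x : Bool × L, (if ∃ l ∉ W φ, Crossed vy vz T l β x then (1 : ℝ) else 0) := by
          intro β
          rw [eq_sub_iff_add_eq, ← Finset.expect_add_distrib]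
          refine (Finset.expect_congr rfl fun x _ => ?_).trans
            (Fintype.expect_const (ι := Bool × L) (1 : ℝ))
          split_ifs <;> norm_num
        have h2 : ∀ β, 0 ≤ 𝔼 x : Bool × L,
            (if ∃ l ∉ W φ, Crossed vy vz T l β x then (0 : ℝ) else 1) := fun β =>
          Finset.expect_nonneg fun x _ => by split_ifs <;> norm_num
        calc _ ≤ ∏ β, Real.exp (-𝔼 x : Bool × L,
                (if ∃ l ∉ W φ, Crossed vy vz T l β x then (1 : ℝ) else 0)) := by
              refine Finset.prod_le_prod (fun β _ => h2 β) fun β _ => ?_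
              rw [h1]
              exact Real.one_sub_le_exp_neg _
          _ ≤ _ := by
              rw [← Real.exp_sum, Finset.sum_neg_distrib]
              exact Real.exp_le_exp.2 (neg_le_neg (hE (W φ) (hW φ)))
    _ = _ := by simp

/-- The sign of a label. -/
def labelSign (c : Label) : ℤ :=
  match c with
  | .y => 1
  | .z => -1
  | .zero => 0
  | .one => 0

omit [Fintype V] [DecidableEq V] in
theorem sum_labelSign (lab : V → Label) (S : Finset V) :
    ∑ v ∈ S, labelSign (lab v) = #{v ∈ S | lab v = .y} - #{v ∈ S | lab v = .z} := by
  simp only [Finset.card_filter, Nat.cast_sum, ← Finset.sum_sub_distrib]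
  refine Finset.sum_congr rfl fun v _ => ?_
  cases lab v <;> simp [labelSign]

-- Exchanging the labels of a pair shifts the imbalance of `S` by ±2 if `S` contains exactly one
-- variable of the pair, and leaves it unchanged otherwise.
omit [Fintype V] in
theorem sum_labelSign_swap {lab lab' : V → Label} {y z : V} (hyz : y ≠ z)
    (hl : ∀ v, v ≠ y → v ≠ z → lab' v = lab v) (hy : labelSign (lab' y) = -labelSign (lab y))
    (hz : labelSign (lab' z) = -labelSign (lab z)) (hs : labelSign (lab z) = -labelSign (lab y))
    (S : Finset V) :
    ∑ v ∈ S, labelSign (lab' v) = ∑ v ∈ S, labelSign (lab v) +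
      ((if z ∈ S then 2 * labelSign (lab y) else 0) -
        (if y ∈ S then 2 * labelSign (lab y) else 0)) := by
  have h : ∀ v, labelSign (lab' v) = labelSign (lab v) +
      ((if v = z then 2 * labelSign (lab y) else 0) -
        (if v = y then 2 * labelSign (lab y) else 0)) := by
    intro v
    by_cases h1 : v = y
    · subst h1
      rw [hy, if_neg hyz, if_pos rfl]; ring
    · by_cases h2 : v = z
      · subst h2
        rw [hz, if_pos rfl, if_neg h1, hs]; ring
      · rw [hl v h1 h2, if_neg h1, if_neg h2]; ring
  simp only [h, Finset.sum_add_distrib, Finset.sum_sub_distrib, Finset.sum_ite_eq']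

omit [Fintype L] [Fintype V] in
/-- Many crossed parts force many unbalanced parts for most choices of the signs. -/
theorem expect_sign_le [Nonempty B] (vy : B → L → V) (vz : B → V) (T : τ → Finset V)
    (hT : Pairwise (Function.onFun Disjoint T)) (q : B → Bool × L)
    (lab : (B → Bool) → V → Label)
    (hne : ∀ β, vy β (q β).2 ≠ vz β)
    (hy : ∀ β sg, (q β).1 = false → lab sg (vy β (q β).2) = signLabel (sg β))
    (hz : ∀ β sg, (q β).1 = false → lab sg (vz β) = signLabel (!sg β))
    (hlab : ∀ β sg v, v ≠ vy β (q β).2 → v ≠ vz β →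
      lab (Function.update sg β (!sg β)) v = lab sg v)
    (f : τ → (B → Bool) → ℝ) (hf0 : ∀ l sg, 0 ≤ f l sg) (hf1 : ∀ l sg, f l sg ≤ 1)
    (hf : ∀ l sg, #{v ∈ T l | lab sg v = .y} ≠ #{v ∈ T l | lab sg v = .z} → f l sg ≤ 3 / 4)
    (M : ℕ) (hM : M ≤ #(touched vy vz T q)) :
    𝔼 sg, ∏ l, f l sg ≤ (24 / 25 : ℝ) ^ M := by
  classical
  have hβ : ∀ l, ∃ β, l ∈ touched vy vz T q → Crossed vy vz T l β (q β) := by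
    intro l
    by_cases hl : l ∈ touched vy vz T q
    · obtain ⟨β, hβ⟩ := (Finset.mem_filter.1 hl).2
      exact ⟨β, fun _ => hβ⟩
    · exact ⟨Classical.arbitrary B, fun h => absurd h hl⟩
  choose b hb using hβ
  -- Each touched part gets one block crossing it. One variable of that block lies in the part
  -- itself, so the other lies in at most one further part: out-degree at most 1. On an independent
  -- `W`, flipping the block of one part does not affect the balance of the others.
  obtain ⟨W, hWN, hcard, hind⟩ := exists_indep
    (fun l l' => l ≠ l' ∧ Crossed vy vz T l' (b l) (q (b l))) (touched vy vz T q) (by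
      intro l hl
      have hcl := hb l hl
      refine Finset.card_le_one.2 fun l₁ h₁ l₂ h₂ => ?_
      obtain ⟨-, n1, c1⟩ := Finset.mem_filter.1 h₁
      obtain ⟨-, n2, c2⟩ := Finset.mem_filter.1 h₂
      by_contra h12
      have dj : ∀ k k', k ≠ k' → ∀ v, v ∈ T k → v ∈ T k' → False := fun k k' h v h1 h2 =>
        Finset.disjoint_left.1 (hT h) h1 h2
      have ex : ∀ p r : Prop, ¬ (p ↔ r) → (p ∧ ¬ r) ∨ (¬ p ∧ r) := fun p r h => by tauto
      rcases ex _ _ hcl.2 with ⟨h, -⟩ | ⟨-, h⟩ <;> rcases ex _ _ c1.2 with ⟨h1, -⟩ | ⟨-, h1⟩ <;>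
        rcases ex _ _ c2.2 with ⟨h2, -⟩ | ⟨-, h2⟩ <;>
        first | exact dj _ _ n1 _ h h1 | exact dj _ _ n2 _ h h2 | exact dj _ _ h12 _ h1 h2)
  let flip : B → Equiv.Perm (B → Bool) := fun β =>
    Function.Involutive.toPerm (fun sg => Function.update sg β (!sg β)) (by
      intro sg; ext β'; by_cases h : β' = β <;> simp [h])
  let F : τ → (B → Bool) → ℝ := fun l sg =>
    if ∑ v ∈ T l, labelSign (lab sg v) = 0 then 1 else 3 / 4
  have hbal : ∀ β sg l, (q β).1 = false → ∑ v ∈ T l, labelSign (lab (flip β sg) v) =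
      ∑ v ∈ T l, labelSign (lab sg v) +
      ((if vz β ∈ T l then 2 * labelSign (signLabel (sg β)) else 0) -
        (if vy β (q β).2 ∈ T l then 2 * labelSign (signLabel (sg β)) else 0)) := by
    intro β sg l hq
    have := sum_labelSign_swap (lab := lab sg) (lab' := lab (flip β sg)) (hne β) (hlab β sg)
      (by
        rw [hy β _ hq, hy β _ hq]
        change labelSign (signLabel (Function.update sg β (!sg β) β)) = _
        rw [Function.update_self]
        cases sg β <;> rfl)
      (by
        rw [hz β _ hq, hz β _ hq]
        change labelSign (signLabel (!(Function.update sg β (!sg β) β))) = _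
        rw [Function.update_self]
        cases sg β <;> rfl)
      (by
        rw [hz β _ hq, hy β _ hq]
        cases sg β <;> rfl) (T l)
    rw [hy β _ hq] at this
    exact this
  have hs2 : ∀ s : Bool, 2 * labelSign (signLabel s) ≠ 0 := by decide
  -- A flip cannot leave the part balanced both before and after, so the average of the two values
  -- is at most (1 + 3/4)/2.
  have key : 𝔼 sg, ∏ l ∈ W, F l sg ≤ (7 / 8 : ℝ) ^ #W := by
    refine expect_prod_le_pow (by norm_num) W (fun l => flip (b l)) F
      (fun l sg => by simp only [F]; split_ifs <;> norm_num) (fun l hl sg => ?_)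
      fun l hl l' hl' hll sg => ?_
    · obtain ⟨hq, hx⟩ := hb l (hWN hl)
      have h := hbal (b l) sg l hq
      have h2 := hs2 (sg (b l))
      have : ¬ (∑ v ∈ T l, labelSign (lab sg v) = 0 ∧
          ∑ v ∈ T l, labelSign (lab (flip (b l) sg) v) = 0) := by
        rintro ⟨e1, e2⟩
        rw [e1, e2] at h
        by_cases hy' : vy (b l) (q (b l)).2 ∈ T l
        · have hz' : vz (b l) ∉ T l := fun h => hx ⟨fun _ => h, fun _ => hy'⟩
          rw [if_pos hy', if_neg hz'] at h
          omega
        · have hz' : vz (b l) ∈ T l := by tauto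
          rw [if_neg hy', if_pos hz'] at h
          omega
      simp only [F]
      split_ifs with h1 h2
      · exact absurd ⟨h1, h2⟩ this
      all_goals norm_num
    · obtain ⟨hq, -⟩ := hb l (hWN hl)
      have hnc : ¬ Crossed vy vz T l' (b l) (q (b l)) := fun hc => hind l hl l' hl' hll ⟨hll, hc⟩
      have hiff : vy (b l) (q (b l)).2 ∈ T l' ↔ vz (b l) ∈ T l' := by
        by_contra h
        exact hnc ⟨hq, h⟩
      have h := hbal (b l) sg l' hq
      simp only [F]
      rw [h]
      simp [hiff]
  -- The origin of 24/25: a third of the parts is kept, and 7/8 ≤ (24/25)^3.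
  have h78 : (7 / 8 : ℝ) ^ #W ≤ (24 / 25 : ℝ) ^ M := by
    calc (7 / 8 : ℝ) ^ #W ≤ ((24 / 25 : ℝ) ^ 3) ^ #W :=
          pow_le_pow_left₀ (by norm_num) (by norm_num) _
      _ = (24 / 25 : ℝ) ^ (3 * #W) := (pow_mul _ _ _).symm
      _ ≤ (24 / 25 : ℝ) ^ M := pow_le_pow_of_le_one (by norm_num) (by norm_num) (by omega)
  refine le_trans (expect_mono fun sg => ?_) (key.trans h78)
  calc ∏ l, f l sg ≤ ∏ l ∈ W, f l sg :=
        Finset.prod_le_prod_of_subset_of_le_one (Finset.subset_univ _) (fun l _ => hf0 l sg)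
          fun l _ _ => hf1 l sg
    _ ≤ ∏ l ∈ W, F l sg := by
        refine Finset.prod_le_prod (fun l _ => hf0 l sg) fun l _ => ?_
        simp only [F]
        split_ifs with h
        · exact hf1 l sg
        · refine hf l sg fun h' => h ?_
          rw [sum_labelSign, h', sub_self]

end Crossing

/-! ### Density of a set of variables among the leaves. -/

section Density

variable {V : Type*} [DecidableEq V] {m d : ℕ}

/-- The proportion of leaves that a copy `e` of the variables has in `S`. -/
noncomputable def dens (e : Vars m d → V) (S : Finset V) : ℝ :=
  𝔼 l : Leaf m d, if e (leafVar m d l) ∈ S then (1 : ℝ) else 0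

theorem dens_le_one [NeZero m] (e : Vars m d → V) (S : Finset V) : dens e S ≤ 1 :=
  expect_le_of_le fun l => by split_ifs <;> norm_num

theorem dens_nonneg (e : Vars m d → V) (S : Finset V) : 0 ≤ dens e S :=
  Finset.expect_nonneg fun l _ => by split_ifs <;> norm_num

theorem dens_le_add (e : Vars m d → V) {S S₁ S₂ : Finset V} (h : S ⊆ S₁ ∪ S₂) :
    dens e S ≤ dens e S₁ + dens e S₂ := by
  unfold dens
  rw [← Finset.expect_add_distrib]
  refine expect_mono fun l => ?_
  by_cases h1 : e (leafVar m d l) ∈ S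
  · rcases Finset.mem_union.1 (h h1) with h2 | h2
    · simp only [h1, h2, if_true]
      split_ifs <;> norm_num
    · simp only [h1, h2, if_true]
      split_ifs <;> norm_num
  · simp only [h1, if_false]
    split_ifs <;> norm_num

theorem dens_mono [NeZero m] (e : Vars m d → V) {S S' : Finset V} (h : S ⊆ S') :
    dens e S ≤ dens e S' := by
  refine expect_mono fun l => ?_
  by_cases h1 : e (leafVar m d l) ∈ S
  · simp [h1, h h1]
  · simp only [h1, if_false]
    split_ifs <;> norm_num

end Density

/-- On average over the random labellings of `n` copies of the variables, products of at most `n`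
functions of depth `D` which together see most of each copy have exponentially small relative
rank. -/
def RankBound (F : Type*) [Field F] (V : Type*) [Fintype V] [DecidableEq V] (m : ℕ) [NeZero m]
    (s : ℕ) (η : ℝ) (D : ℕ) : Prop :=
  ∀ (N : Type) [Fintype N] [DecidableEq N] [Nonempty N] (ι : Type) [Fintype ι] [DecidableEq ι]
    (e : N × Vars m D → V) (lam : V → Label) (S : ι → Finset V) (h : ι → (V → F) → F),
    Function.Injective e → Fintype.card ι ≤ Fintype.card N →
    Pairwise (Function.onFun Disjoint S) → (∀ k, Comp s D (S k) (h k)) →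
    -- The threshold starts above 3/4, so that at depth 0 all four leaves are present. It grows by
    -- `η` per level and must not exceed 7/8 when the hypothesis is applied to a dominating part.
    (∀ v, 13 / 16 + D * η ≤ dens (fun x => e (v, x)) (univ.biUnion S)) →
    𝔼 w : N → Sample m D, ∏ k, relrk
      (Function.extend e (fun p => sampleLabel m D (w p.1) p.2) lam) (S k) (h k) ≤
      (24 / 25 : ℝ) ^ Fintype.card N

/-! ### The rank bound at depth zero. -/

section Base

variable {F : Type*} [Field F] {V : Type*} [Fintype V] [DecidableEq V] {m : ℕ} [NeZero m]

omit [Fintype V] in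
theorem free_eq_card (lab : V → Label) (S : Finset V) :
    free lab S = #{v ∈ S | lab v = .y ∨ lab v = .z} := by
  rw [free, Finset.filter_or, Finset.card_union_of_disjoint]
  exact Finset.disjoint_filter.2 fun v _ h1 h2 => by simp [h1] at h2

/-- Four leaves with density above 3/4 means that every leaf is covered, so the parts contain at
least 4n free variables. At most n affine functions of rank at most 2 then give 2^n · θ^(4n) =
2^(-n), for every outcome. -/
theorem rankBound_zero (s : ℕ) (η : ℝ) : RankBound F V m s η 0 := by
  intro N _ _ _ ι _ _ e lam S h he hcard hS hcomp hdens
  refine expect_le_of_le fun w => ?_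
  set lab := Function.extend e (fun p => sampleLabel m 0 (w p.1) p.2) lam
  have hmem : ∀ v a, e (v, leafVar m 0 a) ∈ univ.biUnion S := by
    intro v a
    by_contra hnot
    have h1 := hdens v
    have h2 : dens (fun x => e (v, x)) (univ.biUnion S) ≤ 3 / 4 := by
      have hc : Fintype.card (Leaf m 0) = 4 := Fintype.card_fin 4
      rw [dens, Fintype.expect_eq_sum_div_card, hc, Finset.sum_boole]
      have : #{l : Leaf m 0 | e (v, leafVar m 0 l) ∈ univ.biUnion S} < 4 := by
        rw [← hc, ← Finset.card_univ]
        exact Finset.card_lt_card (Finset.filter_ssubset.2 ⟨a, mem_univ _, hnot⟩)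
      have : (#{l : Leaf m 0 | e (v, leafVar m 0 l) ∈ univ.biUnion S} : ℝ) ≤ 3 := by
        exact_mod_cast Nat.le_of_lt_succ this
      push_cast
      linarith
    norm_num at h1
    linarith
  have hlab : ∀ v a, lab (e (v, leafVar m 0 a)) = .y ∨ lab (e (v, leafVar m 0 a)) = .z := by
    intro v a
    have : lab (e (v, leafVar m 0 a)) = sampleLabel m 0 (w v) (leafVar m 0 a) :=
      he.extend_apply _ _ _
    have h2 : sampleLabel m 0 (w v) (leafVar m 0 a) =
        if (show Fin 4 from a).val % 2 = 0 then .y else .z := rfl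
    rw [this, h2]
    split_ifs <;> simp
  have hfree : 4 * Fintype.card N ≤ free lab (univ.biUnion S) := by
    have hc : #(univ : Finset (N × Leaf m 0)) = 4 * Fintype.card N := by
      have hc : Fintype.card (Leaf m 0) = 4 := Fintype.card_fin 4
      rw [Finset.card_univ, Fintype.card_prod, hc, mul_comm]
    rw [free_eq_card, ← hc]
    refine Finset.card_le_card_of_injOn (fun p => e (p.1, leafVar m 0 p.2)) (fun p _ => ?_) ?_
    · simp only [coe_filter, Set.mem_ofPred_eq]
      exact ⟨hmem _ _, hlab _ _⟩
    · rintro ⟨v, a⟩ - ⟨v', a'⟩ - h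
      have h1 := he h
      simp only [Prod.mk.injEq] at h1
      have h2 : a = a' := congrArg Prod.fst h1.2
      rw [h1.1, h2]
  calc ∏ k, relrk lab (S k) (h k) ≤ ∏ k, ((2 : ℝ) * theta ^ free lab (S k)) := by
        refine Finset.prod_le_prod (fun k _ => relrk_nonneg _ _ _) fun k _ => ?_
        obtain ⟨c₀, c, hh⟩ := hcomp k
        have h2 : rk lab (h k) ≤ 2 := by
          rw [funext hh]
          exact rk_le (RankLE.of_affine _ _ _)
        unfold relrk
        gcongr
        · exact pow_nonneg theta_pos.le _
        · exact_mod_cast h2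
    _ = 2 ^ Fintype.card ι * theta ^ free lab (univ.biUnion S) := by
        rw [Finset.prod_mul_distrib, Finset.prod_const, Finset.prod_pow_eq_pow_sum,
          free_eq_sum lab univ S fun i _ j _ hij => hS hij, Finset.card_univ]
    _ ≤ 2 ^ Fintype.card N *
          theta ^ (Fintype.card N + (Fintype.card N + 2 * Fintype.card N)) := by
        refine mul_le_mul (pow_le_pow_right₀ (by norm_num) hcard) (pow_le_pow_of_le_one
          theta_pos.le (theta_le.trans (by norm_num)) (by omega)) (pow_nonneg theta_pos.le _)
          (by positivity)
    _ = (1 / 2) ^ Fintype.card N := by rw [two_pow_mul_theta_pow, pow_mul, theta_sq]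
    _ ≤ _ := pow_le_pow_left₀ (by norm_num) (by norm_num) _

end Base

/-! ### Blocks handled by the induction hypothesis. -/

section Step

variable {F : Type*} [Field F] {V : Type*} [Fintype V] [DecidableEq V] {m : ℕ} [NeZero m]
  {B : Type} [Fintype B] [DecidableEq B] {D : ℕ}

/-- The labelling of the whole variable set given by a family of blocks. -/
noncomputable def familyLabel (e : (B × Fin 2) × Vars m D → V) (lam : V → Label)
    (q : B → Bool × Leaf m D) (sg : B → Bool) (sub : B → Sample m D) : V → Label :=
  Function.extend e
    (blockLabel (singleLabel m D) (baseLeaf m D) (sampleLabel m D) q sg sub) lam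

omit [Fintype V] [DecidableEq V] [Fintype B] in
theorem familyLabel_eq_extend (e : (B × Fin 2) × Vars m D → V) (he : Function.Injective e)
    (lam : V → Label) (q : B → Bool × Leaf m D) (sg : B → Bool) (A : Finset B)
    (hA : ∀ β ∈ A, (q β).1 = true) (sub sub₀ : B → Sample m D)
    (hsub : ∀ β ∉ A, sub β = sub₀ β) :
    familyLabel e lam q sg sub = Function.extend
      (fun p : A × Vars m D => e ((p.1.1, 0), p.2))
      (fun p => sampleLabel m D (sub p.1) p.2) (familyLabel e lam q sg sub₀) := by
  have he' : Function.Injective (fun p : A × Vars m D => e ((p.1.1, 0), p.2)) := by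
    rintro ⟨⟨β, hβ⟩, x⟩ ⟨⟨β', hβ'⟩, x'⟩ h
    have := he h
    simp only [Prod.mk.injEq] at this
    obtain ⟨⟨rfl, -⟩, rfl⟩ := this
    rfl
  funext v
  by_cases hv : ∃ p : A × Vars m D, e ((p.1.1, 0), p.2) = v
  · obtain ⟨⟨β, x⟩, rfl⟩ := hv
    rw [he'.extend_apply (a := (β, x))]
    simp only [familyLabel, he.extend_apply, blockLabel, hA β.1 β.2, if_true]
  · rw [Function.extend_apply' _ _ _ hv]
    by_cases hv' : ∃ p, e p = v
    · obtain ⟨⟨⟨β, j⟩, x⟩, rfl⟩ := hv'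
      simp only [familyLabel, he.extend_apply, blockLabel]
      by_cases hβ : β ∈ A
      · have hj : j ≠ 0 := by
          rintro rfl
          exact hv ⟨(⟨β, hβ⟩, x), rfl⟩
        simp [hj]
      · rw [hsub β hβ]
    · simp only [familyLabel, Function.extend_apply' _ _ _ hv']

variable {s : ℕ} {η : ℝ} {τ : Type} [Fintype τ] [DecidableEq τ]

/-- With everything outside the alive blocks `A` fixed, the rest is an arbitrary labelling `lam` for
the induction hypothesis, applied to the first copies of the blocks in `A`. Parts outside `W`
contribute factors at most 1 and are dropped. -/
theorem expect_sub_le (IH : RankBound F V m s η D) (e : (B × Fin 2) × Vars m D → V)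
    (he : Function.Injective e) (lam : V → Label) (T : τ → Finset V) (g : τ → (V → F) → F)
    (hT : Pairwise (Function.onFun Disjoint T)) (hg : ∀ l, Comp s D (T l) (g l))
    (q : B → Bool × Leaf m D) (sg : B → Bool) (A : Finset B) (hA0 : A.Nonempty)
    (hA : ∀ β ∈ A, (q β).1 = true) (W : Finset τ) (hW : #W ≤ #A)
    (hdens : ∀ β ∈ A, 13 / 16 + D * η ≤ dens (fun x => e ((β, 0), x)) (W.biUnion T)) :
    𝔼 sub : B → Sample m D, ∏ l, relrk (familyLabel e lam q sg sub) (T l) (g l) ≤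
      (24 / 25 : ℝ) ^ #A := by
  let E := Equiv.piEquivPiSubtypeProd (fun β => β ∈ A) (fun _ : B => Sample m D)
  have hN : Nonempty A := hA0.to_subtype
  have h1 : 𝔼 sub : B → Sample m D, ∏ l, relrk (familyLabel e lam q sg sub) (T l) (g l) =
      𝔼 p : ({β // β ∈ A} → Sample m D) × ({β // β ∉ A} → Sample m D),
        ∏ l, relrk (familyLabel e lam q sg (E.symm p)) (T l) (g l) :=
    Fintype.expect_equiv E _ _ fun sub => by rw [Equiv.symm_apply_apply]
  rw [h1, expect_prod_type, Finset.expect_comm]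
  refine expect_le_of_le fun rest => ?_
  have hsub : ∀ w β, β ∉ A → E.symm (w, rest) β =
      E.symm (fun _ => Classical.arbitrary _, rest) β := by
    intro w β hβ
    simp [E, Equiv.piEquivPiSubtypeProd, hβ]
  have hlab : ∀ w, familyLabel e lam q sg (E.symm (w, rest)) = Function.extend
      (fun p : A × Vars m D => e ((p.1.1, 0), p.2))
      (fun p => sampleLabel m D (w p.1) p.2)
      (familyLabel e lam q sg (E.symm (fun _ => Classical.arbitrary _, rest))) := by
    intro w
    rw [familyLabel_eq_extend e he lam q sg A hA _ _ (hsub w)]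
    congr 1
    funext p
    have : E.symm (w, rest) p.1 = w p.1 := by
      simp [E, Equiv.piEquivPiSubtypeProd]
    rw [this]
  have hIH := IH A W (fun p => e ((p.1.1, 0), p.2))
    (familyLabel e lam q sg (E.symm (fun _ => Classical.arbitrary _, rest)))
    (fun l => T l) (fun l => g l) (by
      rintro ⟨⟨β, hβ⟩, x⟩ ⟨⟨β', hβ'⟩, x'⟩ h
      have := he h
      simp only [Prod.mk.injEq] at this
      obtain ⟨⟨rfl, -⟩, rfl⟩ := this
      rfl) (by simpa using hW) (fun l l' hne => hT fun h => hne (Subtype.ext h))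
    (fun l => hg l) (by
      rintro ⟨β, hβ⟩
      have hU : univ.biUnion (fun l : W => T l) = W.biUnion T := by
        ext v; simp
      rw [hU]
      exact hdens β hβ)
  rw [Fintype.card_coe] at hIH
  refine le_trans (expect_mono fun w => ?_) hIH
  rw [hlab w]
  refine le_trans ?_ (Finset.prod_coe_sort W fun l => relrk (Function.extend
      (fun p : A × Vars m D => e ((p.1.1, 0), p.2))
      (fun p => sampleLabel m D (w p.1) p.2)
      (familyLabel e lam q sg (E.symm (fun _ => Classical.arbitrary _, rest)))) (T l) (g l)).ge
  exact Finset.prod_le_prod_of_subset_of_le_one (Finset.subset_univ W)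
    (fun l _ => relrk_nonneg _ _ _) fun l _ _ => relrk_le_one (hg l).dependsOn

/-- Any `M` alive blocks of `G` allow the induction hypothesis. The event of fewer alive blocks is
bounded by an exponential moment: its indicator is at most 2^M · 2^(-#alive), and each block of `G`
contributes (1 + 1/2)/2 = 3/4 ≤ exp(-1/4) to the expectation. -/
theorem alive_bound [Nonempty B] (IH : RankBound F V m s η D)
    (e : (B × Fin 2) × Vars m D → V)
    (he : Function.Injective e) (lam : V → Label) (T : τ → Finset V) (g : τ → (V → F) → F)
    (hT : Pairwise (Function.onFun Disjoint T)) (hg : ∀ l, Comp s D (T l) (g l))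
    (M : ℕ) (hM : 0 < M) (G : Finset B)
    (hG : ∀ A ⊆ G, #A = M → ∃ W : Finset τ, #W ≤ M ∧
      ∀ β ∈ A, 13 / 16 + D * η ≤ dens (fun x => e ((β, 0), x)) (W.biUnion T)) :
    𝔼 q : B → Bool × Leaf m D, 𝔼 sg : B → Bool, 𝔼 sub : B → Sample m D,
      ∏ l, relrk (familyLabel e lam q sg sub) (T l) (g l) ≤
      (24 / 25 : ℝ) ^ M + 2 ^ M * Real.exp (-(#G / 4)) := by
  let f : B → Bool × Leaf m D → ℝ := fun β x => if β ∈ G ∧ x.1 = true then 1 / 2 else 1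
  have hf : ∀ q : B → Bool × Leaf m D, ∏ β, f β (q β) = (1 / 2) ^ #{β ∈ G | (q β).1 = true} := by
    intro q
    simp only [f, Finset.prod_ite, Finset.prod_const, one_pow, mul_one]
    congr 2
    ext β; simp
  have h1 : ∀ q : B → Bool × Leaf m D, 𝔼 sg : B → Bool, 𝔼 sub : B → Sample m D,
      ∏ l, relrk (familyLabel e lam q sg sub) (T l) (g l) ≤
      (24 / 25 : ℝ) ^ M + 2 ^ M * ∏ β, f β (q β) := by
    intro q
    rw [hf]
    by_cases hq : M ≤ #{β ∈ G | (q β).1 = true}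
    · obtain ⟨A, hA, hAM⟩ := Finset.exists_subset_card_eq hq
      obtain ⟨W, hW, hd⟩ := hG A (hA.trans (Finset.filter_subset _ _)) hAM
      have : 𝔼 sg : B → Bool, 𝔼 sub : B → Sample m D,
          ∏ l, relrk (familyLabel e lam q sg sub) (T l) (g l) ≤ (24 / 25 : ℝ) ^ M := by
        refine expect_le_of_le fun sg => ?_
        have := expect_sub_le IH e he lam T g hT hg q sg A
          (Finset.card_pos.1 (by omega)) (fun β hβ => (Finset.mem_filter.1 (hA hβ)).2) W
          (by omega) hd
        rwa [hAM] at this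
      have h0 : (0 : ℝ) ≤ 2 ^ M * (1 / 2) ^ #{β ∈ G | (q β).1 = true} := by positivity
      linarith
    · have h2 : 𝔼 sg : B → Bool, 𝔼 sub : B → Sample m D,
          ∏ l, relrk (familyLabel e lam q sg sub) (T l) (g l) ≤ 1 :=
        expect_le_of_le fun sg => expect_le_of_le fun sub =>
          Finset.prod_le_one (fun l _ => relrk_nonneg _ _ _)
            fun l _ => relrk_le_one (hg l).dependsOn
      have h3 : (1 : ℝ) ≤ 2 ^ M * (1 / 2) ^ #{β ∈ G | (q β).1 = true} := by
        calc (1 : ℝ) = 2 ^ M * (1 / 2) ^ M := by rw [← mul_pow]; norm_num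
          _ ≤ _ := mul_le_mul_of_nonneg_left
            (pow_le_pow_of_le_one (by norm_num) (by norm_num) (by omega)) (by positivity)
      have h4 : (0 : ℝ) ≤ (24 / 25 : ℝ) ^ M := by positivity
      linarith
  refine (expect_mono h1).trans ?_
  rw [Finset.expect_add_distrib, Fintype.expect_const, ← Finset.mul_expect, expect_pi_prod]
  gcongr
  have h5 : ∀ β, 𝔼 x, f β x = if β ∈ G then 3 / 4 else 1 := by
    intro β
    rw [expect_prod_type, Fintype.expect_eq_sum_div_card, Fintype.sum_bool]
    simp only [f, Fintype.expect_const]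
    split_ifs <;> simp_all; norm_num
  simp only [h5, Finset.prod_ite, Finset.prod_const, one_pow, mul_one]
  have h6 : (3 / 4 : ℝ) ≤ Real.exp (-(1 / 4)) := by
    have := Real.add_one_le_exp (-(1 / 4) : ℝ)
    linarith
  calc (3 / 4 : ℝ) ^ #{β | β ∈ G} ≤ Real.exp (-(1 / 4)) ^ #{β | β ∈ G} :=
        pow_le_pow_left₀ (by norm_num) h6 _
    _ = Real.exp (-(#G / 4)) := by
        rw [← Real.exp_nat_mul]
        congr 1
        rw [Finset.filter_mem_eq_inter, Finset.univ_inter]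
        ring

end Step

/-! ### Blocks whose leaves are spread over many parts. -/

section Step

variable {F : Type*} [Field F] {V : Type*} [Fintype V] [DecidableEq V] {m : ℕ} [NeZero m]
  {B : Type} [Fintype B] [DecidableEq B] {D s : ℕ} {η : ℝ} {τ : Type} [Fintype τ] [DecidableEq τ]

-- If the fixed variable `vz β` lies in a part outside `W`, that part is crossed whenever the random
-- leaf misses it, with probability at least 1/8. Otherwise every leaf in `R` gives a crossing. The
-- block is collapsed with probability 1/2, which turns 1/8 into 1/16.
omit [Fintype V] [Fintype B] [DecidableEq B] in
open Classical in
theorem expect_crossed_ge (T : τ → Finset V) (W : Finset τ)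
    (vy : B → Leaf m D → V) (vz : B → V) (β : B) (R : Finset V)
    (hR : ∀ v, v ∈ R → ∃ l ∉ W, v ∈ T l) {e : Vars m D → V}
    (hvy : ∀ l, vy β l = e (leafVar m D l)) (hlt : ∀ l, dens e (T l) ≤ 7 / 8) :
    dens e R / 16 ≤
      𝔼 x : Bool × Leaf m D, if ∃ l ∉ W, Crossed vy vz T l β x then (1 : ℝ) else 0 := by
  have h1 : dens e R / 8 ≤ 𝔼 x : Leaf m D,
      if ∃ l ∉ W, Crossed vy vz T l β (false, x) then (1 : ℝ) else 0 := by
    by_cases hz : ∃ l ∉ W, vz β ∈ T l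
    · obtain ⟨l, hl, hz⟩ := hz
      have h2 : 𝔼 x : Leaf m D, ((1 : ℝ) - if e (leafVar m D x) ∈ T l then (1 : ℝ) else 0) ≤
          𝔼 x : Leaf m D,
            if ∃ l ∉ W, Crossed vy vz T l β (false, x) then (1 : ℝ) else 0 := by
        refine expect_mono fun x => ?_
        by_cases hx : e (leafVar m D x) ∈ T l
        · simp only [hx, if_true, sub_self]
          split_ifs <;> norm_num
        · have : ∃ l ∉ W, Crossed vy vz T l β (false, x) :=
            ⟨l, hl, rfl, by simp only [hvy]; tauto⟩
          simp [hx, this]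
      rw [Finset.expect_sub_distrib, Fintype.expect_const] at h2
      have h3 := hlt l
      have h4 := dens_le_one e R
      unfold dens at h3
      linarith
    · have h2 : dens e R ≤ 𝔼 x : Leaf m D,
          if ∃ l ∉ W, Crossed vy vz T l β (false, x) then (1 : ℝ) else 0 := by
        refine expect_mono fun x => ?_
        by_cases hx : e (leafVar m D x) ∈ R
        · obtain ⟨l, hl, hl'⟩ := hR _ hx
          have : ∃ l ∉ W, Crossed vy vz T l β (false, x) := by
            refine ⟨l, hl, rfl, fun h => hz ⟨l, hl, h.1 ?_⟩⟩
            simpa only [hvy] using hl'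
          simp [hx, this]
        · simp only [hx, if_false]
          split_ifs <;> norm_num
      have := dens_nonneg e R
      linarith
  rw [expect_prod_type, Fintype.expect_eq_sum_div_card, Fintype.sum_bool, Fintype.card_bool]
  have h2 : 0 ≤ 𝔼 x : Leaf m D,
      if ∃ l ∉ W, Crossed vy vz T l β (true, x) then (1 : ℝ) else 0 :=
    Finset.expect_nonneg fun l _ => by split_ifs <;> norm_num
  push_cast
  linarith

/-- Outside any `M` parts an average density of 4δ remains, and dominated blocks account for at most
δ of it, so at least 3δb/16 crossings are expected. Either at most `M` parts are touched, which is
unlikely, or the random signs supply the factor (24/25)^M. -/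
theorem split_bound [Nonempty B] [Nonempty V] (e : (B × Fin 2) × Vars m D → V)
    (he : Function.Injective e) (lam : V → Label) (T : τ → Finset V) (g : τ → (V → F) → F)
    (hT : Pairwise (Function.onFun Disjoint T)) (hg : ∀ l, Comp s D (T l) (g l))
    (M : ℕ) {a δ : ℝ} {b : ℝ} (hb : b = Fintype.card B)
    (havg : a ≤ 𝔼 β, dens (fun x => e ((β, 0), x)) (univ.biUnion T))
    (hfew : ∀ W : Finset τ, #W ≤ M →
      𝔼 β, dens (fun x => e ((β, 0), x)) (W.biUnion T) ≤ a - 4 * δ)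
    (hunsplit : (#{β | ∃ l, 7 / 8 ≤ dens (fun x => e ((β, 0), x)) (T l)} : ℝ) ≤ δ * b) :
    𝔼 q : B → Bool × Leaf m D, 𝔼 sg : B → Bool, 𝔼 sub : B → Sample m D,
      ∏ l, relrk (familyLabel e lam q sg sub) (T l) (g l) ≤
      (Fintype.card V : ℝ) ^ M * Real.exp (-(3 * δ * b / 16)) + (24 / 25 : ℝ) ^ M := by
  classical
  let vy : B → Leaf m D → V := fun β l => e ((β, 0), leafVar m D l)
  let vz : B → V := fun β => e ((β, 1), leafVar m D (baseLeaf m D))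
  have hb0 : (0 : ℝ) < b := by rw [hb]; exact_mod_cast Fintype.card_pos
  have hE : ∀ W : Finset τ, #W ≤ M → 3 * δ * b / 16 ≤ ∑ β, 𝔼 x : Bool × Leaf m D,
      if ∃ l ∉ W, Crossed vy vz T l β x then (1 : ℝ) else 0 := by
    intro W hW
    let U : Finset B := {β | ∃ l, 7 / 8 ≤ dens (fun x => e ((β, 0), x)) (T l)}
    let R : Finset V := Wᶜ.biUnion T
    have h1 : ∀ β, (dens (fun x => e ((β, 0), x)) R - if β ∈ U then 1 else 0) / 16 ≤
        𝔼 x : Bool × Leaf m D, if ∃ l ∉ W, Crossed vy vz T l β x then (1 : ℝ) else 0 := by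
      intro β
      by_cases hβ : β ∈ U
      · have h2 : (0 : ℝ) ≤ 𝔼 x : Bool × Leaf m D,
            if ∃ l ∉ W, Crossed vy vz T l β x then (1 : ℝ) else 0 :=
          Finset.expect_nonneg fun l _ => by split_ifs <;> norm_num
        have h3 := dens_le_one (fun x => e ((β, 0), x)) R
        simp only [hβ, if_true]
        linarith
      · simp only [hβ, if_false, sub_zero]
        refine expect_crossed_ge T W vy vz β R (fun v hv => ?_) (fun l => rfl) fun l => ?_
        · obtain ⟨l, hl, hv⟩ := Finset.mem_biUnion.1 hv
          exact ⟨l, Finset.mem_compl.1 hl, hv⟩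
        · by_contra h
          exact hβ (Finset.mem_filter.2 ⟨mem_univ _, l, (not_le.1 h).le⟩)
    have h2 : 𝔼 β, dens (fun x => e ((β, 0), x)) (univ.biUnion T) ≤
        𝔼 β, dens (fun x => e ((β, 0), x)) (W.biUnion T) +
          𝔼 β, dens (fun x => e ((β, 0), x)) R := by
      rw [← Finset.expect_add_distrib]
      refine expect_mono fun β => dens_le_add _ fun v hv => ?_
      obtain ⟨l, -, hv⟩ := Finset.mem_biUnion.1 hv
      by_cases hl : l ∈ W
      · exact Finset.mem_union_left _ (Finset.mem_biUnion.2 ⟨l, hl, hv⟩)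
      · exact Finset.mem_union_right _ (Finset.mem_biUnion.2 ⟨l, Finset.mem_compl.2 hl, hv⟩)
    have h3 := hfew W hW
    have h4 : 4 * δ ≤ 𝔼 β, dens (fun x => e ((β, 0), x)) R := by linarith
    rw [Fintype.expect_eq_sum_div_card, ← hb, le_div_iff₀ hb0] at h4
    refine le_trans ?_ (Finset.sum_le_sum fun β _ => h1 β)
    rw [← Finset.sum_div, Finset.sum_sub_distrib, Finset.sum_boole]
    have h5 : (#{β | β ∈ U} : ℝ) ≤ δ * b := by
      simpa [U] using hunsplit
    linarith
  have h := expect_card_touched_le vy vz T hT M _ hE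
  have hq : ∀ q : B → Bool × Leaf m D, 𝔼 sg : B → Bool, 𝔼 sub : B → Sample m D,
      ∏ l, relrk (familyLabel e lam q sg sub) (T l) (g l) ≤
      (if #(touched vy vz T q) ≤ M then (1 : ℝ) else 0) + (24 / 25 : ℝ) ^ M := by
    intro q
    split_ifs with hM
    · have h2 : 𝔼 sg : B → Bool, 𝔼 sub : B → Sample m D,
          ∏ l, relrk (familyLabel e lam q sg sub) (T l) (g l) ≤ 1 :=
        expect_le_of_le fun sg => expect_le_of_le fun sub =>
          Finset.prod_le_one (fun l _ => relrk_nonneg _ _ _)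
            fun l _ => relrk_le_one (hg l).dependsOn
      have : (0 : ℝ) ≤ (24 / 25 : ℝ) ^ M := by positivity
      linarith
    · rw [zero_add, Finset.expect_comm]
      refine expect_le_of_le fun sub => ?_
      have hf : ∀ sg (v : (B × Fin 2) × Vars m D), familyLabel e lam q sg sub (e v) =
          blockLabel (singleLabel m D) (baseLeaf m D) (sampleLabel m D) q sg sub v :=
        fun sg v => he.extend_apply _ _ _
      refine expect_sign_le vy vz T hT q (fun sg => familyLabel e lam q sg sub) ?_ ?_ ?_ ?_
        (fun l sg => relrk (familyLabel e lam q sg sub) (T l) (g l))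
        (fun l sg => relrk_nonneg _ _ _) (fun l sg => relrk_le_one (hg l).dependsOn)
        (fun l sg => relrk_le_of_ne (hg l).dependsOn) M (not_le.1 hM).le
      · intro β heq
        have := he heq
        simp at this
      · intro β sg hβ
        simp only [vy, hf, blockLabel, hβ, if_true]
        simp [singleLabel_leafVar]
      · intro β sg hβ
        simp only [vz, hf, blockLabel, hβ]
        simp [singleLabel_leafVar]
      · intro β sg v hvy hvz
        by_cases hv : ∃ p, e p = v
        · obtain ⟨⟨⟨β', j⟩, x⟩, rfl⟩ := hv
          simp only [hf, blockLabel]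
          by_cases hββ : β' = β
          · subst hββ
            by_cases hj : j = 0
            · subst hj
              have hx : x ≠ leafVar m D (q β').2 := by
                rintro rfl
                exact hvy rfl
              simp only [if_true]
              rw [singleLabel_congr _ _ _ (signLabel (sg β')) _ hx]
            · obtain rfl : j = 1 := by omega
              have hx : x ≠ leafVar m D (baseLeaf m D) := by
                rintro rfl
                exact hvz rfl
              simp only [hj, if_false]
              rw [singleLabel_congr _ _ _ (signLabel (!sg β')) _ hx]
          · rw [Function.update_of_ne hββ]
        · simp only [familyLabel, Function.extend_apply' _ _ _ hv]
  calc _ ≤ _ := expect_mono hq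
    _ = _ := by rw [Finset.expect_add_distrib, Fintype.expect_const]
    _ ≤ _ := by gcongr

/-- The bound for one level of blocks. -/
theorem block_bound [Nonempty B] (IH : RankBound F V m s η D)
    (e : (B × Fin 2) × Vars m D → V)
    (he : Function.Injective e) (lam : V → Label) (T : τ → Finset V) (g : τ → (V → F) → F)
    (hT : Pairwise (Function.onFun Disjoint T)) (hg : ∀ l, Comp s D (T l) (g l))
    (M : ℕ) (hM : 0 < M) (hη : 0 ≤ η) (hη' : D * η ≤ 1 / 16)
    (havg : 13 / 16 + (D + 1) * η ≤ 𝔼 β, dens (fun x => e ((β, 0), x)) (univ.biUnion T))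
    (hV : 2 ≤ Fintype.card V)
    (hnum : (Fintype.card V : ℝ) ^ M * Real.exp (-(3 * η * Fintype.card B / 128)) ≤
      (24 / 25 : ℝ) ^ M) :
    𝔼 q : B → Bool × Leaf m D, 𝔼 sg : B → Bool, 𝔼 sub : B → Sample m D,
      ∏ l, relrk (familyLabel e lam q sg sub) (T l) (g l) ≤ 2 * (24 / 25 : ℝ) ^ M := by
  classical
  have hVn : Nonempty V := Fintype.card_pos_iff.1 (by omega)
  have hb0 : (0 : ℝ) < Fintype.card B := by exact_mod_cast Fintype.card_pos
  -- The tail of `alive_bound` follows from `hnum`, since 2 ≤ |V| and 1/32 ≥ 3/128.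
  have hGnum : ∀ G : Finset B, η / 8 * Fintype.card B ≤ #G →
      2 ^ M * Real.exp (-(#G / 4)) ≤ (24 / 25 : ℝ) ^ M := by
    intro G hG
    refine le_trans (mul_le_mul (pow_le_pow_left₀ (by norm_num) (by exact_mod_cast hV) M)
      (Real.exp_le_exp.2 ?_) (Real.exp_pos _).le (by positivity)) hnum
    have : 0 ≤ η * Fintype.card B := by positivity
    linarith
  -- Here δ = η/8. A set `W` violating this has average density above 13/16 + Dη + η/2, and as
  -- densities are at most 1, at least a proportion η/2 of the blocks reaches the threshold 13/16 +
  -- Dη.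
  by_cases hfew : ∀ W : Finset τ, #W ≤ M →
      𝔼 β, dens (fun x => e ((β, 0), x)) (W.biUnion T) ≤
        13 / 16 + (D + 1) * η - 4 * (η / 8)
  · by_cases hun : (#{β | ∃ l, 7 / 8 ≤ dens (fun x => e ((β, 0), x)) (T l)} : ℝ) ≤
        η / 8 * Fintype.card B
    · have := split_bound e he lam T g hT hg M rfl havg hfew hun
      have h2 : (3 * (η / 8) * Fintype.card B / 16 : ℝ) = 3 * η * Fintype.card B / 128 := by ring
      rw [h2] at this
      linarith
    · have h1 := alive_bound IH e he lam T g hT hg M hM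
        {β | ∃ l, 7 / 8 ≤ dens (fun x => e ((β, 0), x)) (T l)} (by
          intro A hA hAM
          have hex : ∀ β : B, ∃ l, β ∈ A → 7 / 8 ≤ dens (fun x => e ((β, 0), x)) (T l) := by
            intro β
            by_cases hβ : β ∈ A
            · obtain ⟨l, hl⟩ := (Finset.mem_filter.1 (hA hβ)).2
              exact ⟨l, fun _ => hl⟩
            · obtain ⟨β', hβ'⟩ := Finset.card_pos.1 (hAM ▸ hM)
              obtain ⟨l, -⟩ := (Finset.mem_filter.1 (hA hβ')).2
              exact ⟨l, fun h => absurd h hβ⟩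
          choose l hl using hex
          -- One dominating part per block suffices: 7/8 ≥ 13/16 + Dη because Dη ≤ 1/16.
          refine ⟨A.image l, hAM ▸ Finset.card_image_le, fun β hβ => ?_⟩
          have h2 := dens_mono (fun x => e ((β, 0), x))
            (Finset.subset_biUnion_of_mem T (Finset.mem_image_of_mem l hβ))
          have h3 := hl β hβ
          linarith)
      have h2 := hGnum _ (not_le.1 hun).le
      linarith
  · push Not at hfew
    obtain ⟨W, hW, hd⟩ := hfew
    let G : Finset B := {β | 13 / 16 + D * η ≤ dens (fun x => e ((β, 0), x)) (W.biUnion T)}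
    have h1 := alive_bound IH e he lam T g hT hg M hM G (by
      intro A hA hAM
      exact ⟨W, hW, fun β hβ => (Finset.mem_filter.1 (hA hβ)).2⟩)
    have hG : η / 8 * Fintype.card B ≤ #G := by
      have h3 : 𝔼 β, dens (fun x => e ((β, 0), x)) (W.biUnion T) ≤
          𝔼 β, ((13 / 16 + D * η) + if β ∈ G then (1 : ℝ) else 0) := by
        refine expect_mono fun β => ?_
        have h4 := dens_le_one (fun x => e ((β, 0), x)) (W.biUnion T)
        have h5 : 0 ≤ D * η := by positivity
        by_cases hβ : β ∈ G
        · simp only [hβ, if_true]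
          linarith
        · simp only [hβ, if_false, add_zero]
          by_contra h
          exact hβ (Finset.mem_filter.2 ⟨mem_univ _, (not_le.1 h).le⟩)
      have h6 : 𝔼 β, (if β ∈ G then (1 : ℝ) else 0) = #G / Fintype.card B := by
        rw [Fintype.expect_eq_sum_div_card, Finset.sum_boole, Finset.filter_mem_eq_inter,
          Finset.univ_inter]
      rw [Finset.expect_add_distrib, Fintype.expect_const, h6] at h3
      have h7 : η / 2 ≤ #G / Fintype.card B := by linarith
      rw [le_div_iff₀ hb0] at h7
      have : 0 ≤ η * Fintype.card B := by positivity
      linarith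
    have h2 := hGnum _ hG
    linarith

end Step

/-! ### Induction on the depth. -/

section Induction

variable {F : Type*} [Field F] {V : Type*} [Fintype V] [DecidableEq V] {m : ℕ} [NeZero m]
  {D s : ℕ} {η : ℝ}

omit [Fintype V] [NeZero m] in
theorem dens_succ (e : Vars m (D + 1) → V) (S : Finset V) :
    dens e S = 𝔼 i : Fin m, dens (fun x => e (mkSucc i 0 x)) S :=
  expect_prod_type (fun p : Fin m × Leaf m D =>
    if e (leafVar m (D + 1) p) ∈ S then (1 : ℝ) else 0)

/-- Independent samples for a family of copies, regrouped by blocks. -/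
def sampleEquiv (N : Type) (m D : ℕ) : (N → Sample m (D + 1)) ≃
    (N × Fin m → Bool × Leaf m D) × (N × Fin m → Bool) × (N × Fin m → Sample m D) where
  toFun w := (fun β => (w β.1).1 β.2, fun β => (w β.1).2.1 β.2, fun β => (w β.1).2.2 β.2)
  invFun p := fun v => (fun i => p.1 (v, i), fun i => p.2.1 (v, i), fun i => p.2.2 (v, i))
  left_inv _ := rfl
  right_inv _ := rfl

omit [Fintype V] [DecidableEq V] [NeZero m] in
theorem injective_blockEmb {N : Type} (e : N × Vars m (D + 1) → V)
    (he : Function.Injective e) : Function.Injective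
      (fun p : ((N × Fin m) × Fin 2) × Vars m D => e (p.1.1.1, mkSucc p.1.1.2 p.1.2 p.2)) := by
  rintro ⟨⟨⟨v, i⟩, j⟩, x⟩ ⟨⟨⟨v', i'⟩, j'⟩, x'⟩ h
  have h1 := he h
  obtain ⟨rfl, h2⟩ := Prod.mk.inj h1
  obtain ⟨h3, rfl⟩ := Prod.mk.inj h2
  obtain ⟨rfl, rfl⟩ := Prod.mk.inj h3
  rfl

omit [Fintype V] [DecidableEq V] in
theorem extend_sampleLabel_succ {N : Type} (e : N × Vars m (D + 1) → V)
    (he : Function.Injective e) (lam : V → Label) (w : N → Sample m (D + 1)) :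
    Function.extend e (fun p => sampleLabel m (D + 1) (w p.1) p.2) lam =
      familyLabel (fun p : ((N × Fin m) × Fin 2) × Vars m D =>
        e (p.1.1.1, mkSucc p.1.1.2 p.1.2 p.2)) lam (sampleEquiv N m D w).1
        (sampleEquiv N m D w).2.1 (sampleEquiv N m D w).2.2 := by
  have he' := injective_blockEmb e he
  funext v
  by_cases hv : ∃ p, e p = v
  · obtain ⟨⟨u, ⟨⟨i, j⟩, x⟩⟩, rfl⟩ := hv
    rw [he.extend_apply]
    exact (he'.extend_apply (blockLabel (singleLabel m D) (baseLeaf m D) (sampleLabel m D)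
      (sampleEquiv N m D w).1 (sampleEquiv N m D w).2.1 (sampleEquiv N m D w).2.2) lam
      (((u, i), j), x)).symm
  · rw [familyLabel, Function.extend_apply' _ _ _ hv, Function.extend_apply']
    rintro ⟨p, hp⟩
    exact hv ⟨_, hp⟩

theorem prod_relrk_le {ι : Type} [Fintype ι] [DecidableEq ι] (lam : V → Label) (S : ι → Finset V)
    (h : ι → (V → F) → F) (n : ι → Fin s → ℕ) (c : ι → Fin s → F)
    (T : ∀ k t, Option (Fin (n k t)) → Finset V) (g : ∀ k t, Option (Fin (n k t)) → (V → F) → F)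
    (hcov : ∀ k t, univ.biUnion (T k t) = S k)
    (hdis : ∀ k t, Pairwise fun l l' => Disjoint (T k t l) (T k t l'))
    (hh : ∀ k x, h k x = ∑ t, c k t * ∏ l, g k t l x) :
    ∏ k, relrk lam (S k) (h k) ≤ ∑ t : ι → Fin s,
      ∏ p : Σ k, Option (Fin (n k (t k))), relrk lam (T p.1 (t p.1) p.2)
        (g p.1 (t p.1) p.2) := by
  calc ∏ k, relrk lam (S k) (h k)
      ≤ ∏ k, ∑ t, ∏ l, relrk lam (T k t l) (g k t l) := by
        refine Finset.prod_le_prod (fun k _ => relrk_nonneg _ _ _) fun k _ => ?_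
        rw [funext (hh k)]
        exact relrk_sum_prod_le lam (S k) (c k) (T k) (g k) (hdis k) (hcov k)
    _ = ∑ t : ι → Fin s, ∏ k, ∏ l, relrk lam (T k (t k) l) (g k (t k) l) := by
        rw [Finset.prod_univ_sum, Fintype.piFinset_univ]
    _ = _ := Finset.sum_congr rfl fun t _ => (Fintype.prod_sigma
        (fun p : Σ k, Option (Fin (n k (t k))) =>
          relrk lam (T p.1 (t p.1) p.2) (g p.1 (t p.1) p.2))).symm

-- The expansion yields at most s^n terms, and each is at most 2(24/25)^(Kn) by `block_bound` with
-- `M = K * nN` over `N × Fin m`. The average over the blocks of one copy is its density one level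
-- up, and `hnum` raised to the power n is the numerical condition needed there.
set_option maxHeartbeats 1000000 in
theorem rankBound_succ (hs : 0 < s) (IH : RankBound F V m s η D) (hη : 0 ≤ η)
    (hη' : D * η ≤ 1 / 16) (K : ℕ) (hK : 0 < K) (hV : 2 ≤ Fintype.card V)
    (hnum : (Fintype.card V : ℝ) ^ K * Real.exp (-(3 * η * m / 128)) ≤ (24 / 25 : ℝ) ^ K)
    (hs2 : 2 * s * (24 / 25 : ℝ) ^ K ≤ 24 / 25) : RankBound F V m s η (D + 1) := by
  intro N _ _ _ ι _ _ e lam S h he hcard hS hcomp hdens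
  choose n c T g hcov hdis hg hh using fun k => (hcomp k).exists_cover hs
  set nN := Fintype.card N
  let lab : (N → Sample m (D + 1)) → V → Label := fun w =>
    Function.extend e (fun p => sampleLabel m (D + 1) (w p.1) p.2) lam
  have hexp : ∀ w, ∏ k, relrk (lab w) (S k) (h k) ≤ ∑ t : ι → Fin s,
      ∏ p : Σ k, Option (Fin (n k (t k))), relrk (lab w) (T p.1 (t p.1) p.2)
        (g p.1 (t p.1) p.2) :=
    fun w => prod_relrk_le (lab w) S h n c T g hcov hdis hh
  have hN0 : 0 < nN := Fintype.card_pos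
  have hterm : ∀ t : ι → Fin s, 𝔼 w, ∏ p : Σ k, Option (Fin (n k (t k))),
      relrk (lab w) (T p.1 (t p.1) p.2) (g p.1 (t p.1) p.2) ≤
      2 * (24 / 25 : ℝ) ^ (K * nN) := by
    intro t
    let e' : ((N × Fin m) × Fin 2) × Vars m D → V := fun p =>
      e (p.1.1.1, mkSucc p.1.1.2 p.1.2 p.2)
    have he' : Function.Injective e' := injective_blockEmb e he
    have hB : Nonempty (N × Fin m) := inferInstance
    have hU : univ.biUnion (fun p : Σ k, Option (Fin (n k (t k))) => T p.1 (t p.1) p.2) =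
        univ.biUnion S := by
      ext v
      simp only [Finset.mem_biUnion, mem_univ, true_and, Sigma.exists]
      refine exists_congr fun k => ?_
      rw [← hcov k (t k)]
      simp only [Finset.mem_biUnion, mem_univ, true_and]
    have hblock := block_bound (B := N × Fin m) (τ := Σ k, Option (Fin (n k (t k)))) IH e' he'
      lam (fun p => T p.1 (t p.1) p.2) (fun p => g p.1 (t p.1) p.2) (by
        rintro ⟨k, l⟩ ⟨k', l'⟩ hne
        by_cases hk : k = k'
        · subst hk
          exact hdis k (t k) fun hl => hne (congrArg (Sigma.mk k) hl)
        · refine (hS hk).mono ?_ ?_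
          · rw [← hcov k (t k)]
            exact Finset.subset_biUnion_of_mem _ (mem_univ l)
          · rw [← hcov k' (t k')]
            exact Finset.subset_biUnion_of_mem _ (mem_univ l'))
      (fun p => hg p.1 (t p.1) p.2) (K * nN) (Nat.mul_pos hK hN0) hη hη' (by
        rw [hU, expect_prod_type]
        have h1 : ∀ v, 13 / 16 + (D + 1) * η ≤
            𝔼 i : Fin m, dens (fun x => e' (((v, i), 0), x)) (univ.biUnion S) := by
          intro v
          have := hdens v
          rw [dens_succ] at this
          push_cast at this
          exact this
        calc 13 / 16 + (D + 1) * η = 𝔼 v : N, (13 / 16 + (D + 1) * η) :=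
              (Fintype.expect_const _).symm
          _ ≤ _ := expect_mono h1) hV (by
        have h2 : (Fintype.card V : ℝ) ^ (K * nN) *
            Real.exp (-(3 * η * Fintype.card (N × Fin m) / 128)) =
            ((Fintype.card V : ℝ) ^ K * Real.exp (-(3 * η * m / 128))) ^ nN := by
          rw [mul_pow, ← pow_mul, ← Real.exp_nat_mul, Fintype.card_prod, Fintype.card_fin]
          congr 2
          push_cast
          ring
        rw [h2, pow_mul]
        exact pow_le_pow_left₀ (by positivity) hnum _)
    refine le_trans (le_of_eq ?_) hblock
    rw [Fintype.expect_equiv (sampleEquiv N m D) _ (fun p => ∏ l : Σ k, Option (Fin (n k (t k))),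
      relrk (familyLabel e' lam p.1 p.2.1 p.2.2) (T l.1 (t l.1) l.2) (g l.1 (t l.1) l.2))
      (fun w => by
        simp only [lab, extend_sampleLabel_succ e he lam w]
        rfl), expect_prod_type]
    refine Finset.expect_congr rfl fun q _ => ?_
    rw [expect_prod_type]
  calc 𝔼 w, ∏ k, relrk (lab w) (S k) (h k)
      ≤ 𝔼 w, ∑ t : ι → Fin s, ∏ p : Σ k, Option (Fin (n k (t k))),
          relrk (lab w) (T p.1 (t p.1) p.2) (g p.1 (t p.1) p.2) := expect_mono hexp
    _ = ∑ t : ι → Fin s, 𝔼 w, ∏ p : Σ k, Option (Fin (n k (t k))),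
          relrk (lab w) (T p.1 (t p.1) p.2) (g p.1 (t p.1) p.2) := Finset.expect_sum_comm _ _ _
    _ ≤ ∑ t : ι → Fin s, 2 * (24 / 25 : ℝ) ^ (K * nN) := Finset.sum_le_sum fun t _ => hterm t
    _ = s ^ Fintype.card ι * (2 * (24 / 25 : ℝ) ^ (K * nN)) := by simp
    _ ≤ s ^ nN * (2 ^ nN * (24 / 25 : ℝ) ^ (K * nN)) := by
        have hs1 : (1 : ℝ) ≤ s := by exact_mod_cast hs
        have h2 : (2 : ℝ) ≤ 2 ^ nN := le_self_pow₀ (by norm_num) (by omega)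
        gcongr
    _ = (2 * s * (24 / 25 : ℝ) ^ K) ^ nN := by
        rw [mul_pow, mul_pow, pow_mul]; ring
    _ ≤ (24 / 25 : ℝ) ^ nN := pow_le_pow_left₀ (by positivity) hs2 _

theorem rankBound (hs : 0 < s) {Δ : ℕ} (hη : 0 ≤ η) (hη' : Δ * η ≤ 1 / 16) (K : ℕ) (hK : 0 < K)
    (hV : 2 ≤ Fintype.card V)
    (hnum : (Fintype.card V : ℝ) ^ K * Real.exp (-(3 * η * m / 128)) ≤ (24 / 25 : ℝ) ^ K)
    (hs2 : 2 * s * (24 / 25 : ℝ) ^ K ≤ 24 / 25) : ∀ D ≤ Δ, RankBound F V m s η D := by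
  intro D
  induction D with
  | zero => exact fun _ => rankBound_zero s η
  | succ D ih =>
    intro hD
    refine rankBound_succ hs (ih (by omega)) hη (le_trans ?_ hη') K hK hV hnum hs2
    gcongr
    omega

/-- The hard polynomial is not a small sum of products of depth `Δ`. -/
theorem lt_of_comp_hardFun {Δ : ℕ} (hΔ : 0 < Δ) (hs : 0 < s)
    (hC : Comp s Δ univ (hardFun F m Δ)) (K : ℕ) (hK : 0 < K)
    (hV : 2 ≤ Fintype.card (Vars m Δ))
    (hnum : (Fintype.card (Vars m Δ) : ℝ) ^ K * Real.exp (-(3 * m / (2048 * Δ))) ≤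
      (24 / 25 : ℝ) ^ K) : 24 / 25 < 2 * s * (24 / 25 : ℝ) ^ K := by
  by_contra hs2
  have hΔ' : (Δ : ℝ) ≠ 0 := by positivity
  have hη : (Δ : ℝ) * (1 / (16 * Δ)) = 1 / 16 := by field_simp
  -- This is the largest `η` with Δη ≤ 1/16, and 3ηm/128 becomes 3m/(2048Δ). One copy and one
  -- function then give an expectation at most 24/25, against full rank.
  have hb := rankBound (F := F) (V := Vars m Δ) (m := m) (η := 1 / (16 * Δ)) hs (by positivity)
    hη.le K hK hV (by
      convert hnum using 4
      field_simp
      ring) (not_lt.1 hs2) Δ le_rfl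
  have h := hb Unit Unit (fun p => p.2) (fun _ => .one) (fun _ => univ) (fun _ => hardFun F m Δ)
    (fun p q hpq => Prod.ext rfl hpq) le_rfl (fun a b hab => absurd rfl hab) (fun _ => hC) (by
      intro v
      rw [hη]
      simp only [dens, Finset.mem_biUnion, mem_univ, true_and, exists_const, if_true,
        Fintype.expect_const]
      norm_num)
  have h1 : (1 : ℝ) ≤ 𝔼 w : Unit → Sample m Δ, ∏ _k : Unit, relrk
      (Function.extend (fun p : Unit × Vars m Δ => p.2)
        (fun p => sampleLabel m Δ (w p.1) p.2) fun _ => .one) univ (hardFun F m Δ) := by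
    have h2 : ∀ w : Unit → Sample m Δ, (1 : ℝ) ≤ ∏ _k : Unit, relrk
        (Function.extend (fun p : Unit × Vars m Δ => p.2)
        (fun p => sampleLabel m Δ (w p.1) p.2) fun _ => .one) univ (hardFun F m Δ) := by
      intro w
      have h3 : (Function.extend (fun p : Unit × Vars m Δ => p.2)
          (fun p => sampleLabel m Δ (w p.1) p.2) fun _ => .one) = sampleLabel m Δ (w ()) := by
        funext v
        exact Function.Injective.extend_apply (f := fun p : Unit × Vars m Δ => p.2)
          (fun p q hpq => Prod.ext rfl hpq) _ _ ((), v)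
      rw [h3]
      simpa using one_le_relrk_hardFun (F := F) Δ (w ())
    calc (1 : ℝ) = 𝔼 w : Unit → Sample m Δ, (1 : ℝ) := (Fintype.expect_const _).symm
      _ ≤ _ := expect_mono h2
  have h4 := h1.trans h
  norm_num at h4

end Induction

/-! ### Choice of parameters. -/

section Numerics

/-- The size bound for multilinear circuits of product-depth at most `Δ`. -/
theorem exp_le_size {F : Type*} [Field F] {σ : Type*} (m Δ : ℕ) (t : ℝ) (ht : 1000 ≤ t)
    (hm : (m : ℝ) = t ^ 8) (hΔ : 1 ≤ Δ) (hΔt : (Δ : ℝ) ≤ t) (e : Vars m Δ ↪ σ)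
    (C : Circuit F σ) (hC : C.IsMultilinear) (hd : C.productDepth ≤ Δ)
    (hP : C.Computes (MvPolynomial.rename e (hardPoly F m Δ))) :
    Real.exp (16 * t) ≤ C.size := by
  have hm1 : (1 : ℝ) ≤ m := by rw [hm]; exact one_le_pow₀ (by linarith)
  have hm0 : m ≠ 0 := by rintro rfl; norm_num at hm1
  have : NeZero m := ⟨hm0⟩
  have hs : 0 < C.size := Fin.pos C.output
  have hcomp : Comp C.size Δ univ (hardFun F m Δ) := comp_of_computes C hC e _ hP Δ hd
  have hcard : Fintype.card (Vars m Δ) = 8 * (2 * m) ^ Δ := by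
    rw [← Nat.card_eq_fintype_card, card_vars, numVars_eq]
  have hV : 2 ≤ Fintype.card (Vars m Δ) := by
    rw [hcard]
    have : 1 ≤ (2 * m) ^ Δ := Nat.one_le_pow _ _ (by omega)
    omega
  -- The cost K log |V| is of order t^4, well below m/Δ ≥ t^7, while the gain (25/24)^K exceeds
  -- exp(16t) because t is large.
  set K := ⌈t ^ 2⌉₊ with hKdef
  have ht2 : (1 : ℝ) ≤ t ^ 2 := one_le_pow₀ (by linarith)
  have hK1 : t ^ 2 ≤ K := Nat.le_ceil _
  have hK2 : (K : ℝ) ≤ 2 * t ^ 2 := by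
    have := Nat.ceil_lt_add_one (by positivity : (0 : ℝ) ≤ t ^ 2)
    linarith
  have hK : 0 < K := by
    have : (0 : ℝ) < K := by linarith
    exact_mod_cast this
  have hlog16 : Real.log (16 * m) ≤ 16 * t := by
    have h1 : (16 : ℝ) * m ≤ (2 * t) ^ 8 := by
      rw [hm, mul_pow]
      have : (0 : ℝ) ≤ t ^ 8 := by positivity
      linarith
    calc Real.log (16 * m) ≤ Real.log ((2 * t) ^ 8) := Real.log_le_log (by positivity) h1
      _ = 8 * Real.log (2 * t) := by rw [Real.log_pow]; norm_num
      _ ≤ 8 * (2 * t) := by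
          have := Real.log_le_self (by linarith : (0 : ℝ) ≤ 2 * t)
          linarith
      _ = 16 * t := by ring
  have hcard16 : (Fintype.card (Vars m Δ) : ℝ) ≤ (16 * m) ^ Δ := by
    rw [hcard]
    push_cast
    calc (8 : ℝ) * (2 * m) ^ Δ ≤ 8 ^ Δ * (2 * m) ^ Δ := by
          gcongr
          exact le_self_pow₀ (by norm_num) (by omega)
      _ = (16 * m) ^ Δ := by rw [← mul_pow]; ring
  have hnum : (Fintype.card (Vars m Δ) : ℝ) ^ K * Real.exp (-(3 * m / (2048 * Δ))) ≤
      (24 / 25 : ℝ) ^ K := by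
    have hΔ0 : (0 : ℝ) < Δ := by exact_mod_cast hΔ
    have h1 : (Fintype.card (Vars m Δ) : ℝ) ≤ Real.exp (16 * t * t) := by
      refine hcard16.trans ?_
      rw [← Real.exp_log (by positivity : (0 : ℝ) < 16 * m), ← Real.exp_nat_mul]
      refine Real.exp_le_exp.2 ?_
      calc (Δ : ℝ) * Real.log (16 * m) ≤ t * (16 * t) := by
            have h0 : 0 ≤ Real.log (16 * m) := Real.log_nonneg (by linarith)
            exact mul_le_mul hΔt hlog16 h0 (by linarith)
        _ = _ := by ring
    have h2 : Real.exp (-1) ≤ 24 / 25 := by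
      have := Real.exp_one_gt_d9
      rw [Real.exp_neg, inv_le_comm₀ (Real.exp_pos _) (by norm_num)]
      norm_num
      linarith
    calc (Fintype.card (Vars m Δ) : ℝ) ^ K * Real.exp (-(3 * m / (2048 * Δ)))
        ≤ Real.exp (16 * t * t) ^ K * Real.exp (-(3 * m / (2048 * Δ))) := by gcongr
      _ = Real.exp (K * (16 * t * t) - 3 * m / (2048 * Δ)) := by
          rw [← Real.exp_nat_mul, ← Real.exp_add, sub_eq_add_neg]
      _ ≤ Real.exp (K * (-1)) := by
          refine Real.exp_le_exp.2 ?_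
          have h3 : 3 * t ^ 7 / 2048 ≤ 3 * m / (2048 * Δ) := by
            rw [div_le_div_iff₀ (by norm_num) (by positivity), hm]
            have : t ^ 7 * Δ ≤ t ^ 7 * t := by gcongr
            nlinarith
          have h4 : (K : ℝ) * (16 * t * t + 1) ≤ 2 * t ^ 2 * (17 * t ^ 2) := by
            refine mul_le_mul hK2 ?_ (by positivity) (by positivity)
            nlinarith
          have h5 : 2 * t ^ 2 * (17 * t ^ 2) ≤ 3 * t ^ 7 / 2048 := by
            have h6 : (1000 : ℝ) ^ 3 ≤ t ^ 3 := by gcongr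
            have h7 : t ^ 7 = t ^ 3 * t ^ 4 := by ring
            have h8 : 2 * t ^ 2 * (17 * t ^ 2) = 34 * t ^ 4 := by ring
            have h9 : (0 : ℝ) ≤ t ^ 4 := by positivity
            rw [h7, h8]
            nlinarith
          linarith
      _ = Real.exp (-1) ^ K := Real.exp_nat_mul _ _
      _ ≤ _ := pow_le_pow_left₀ (Real.exp_pos _).le h2 _
  have hmain := lt_of_comp_hardFun (F := F) hΔ hs hcomp K hK hV hnum
  have h10 : (24 / 25 : ℝ) ≤ Real.exp (-(1 / 25)) := by
    have := Real.add_one_le_exp (-(1 / 25) : ℝ)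
    linarith
  have h11 : (24 / 25 : ℝ) ^ K ≤ Real.exp (-(t ^ 2 / 25)) := by
    calc (24 / 25 : ℝ) ^ K ≤ Real.exp (-(1 / 25)) ^ K := pow_le_pow_left₀ (by norm_num) h10 _
      _ = Real.exp (K * -(1 / 25)) := (Real.exp_nat_mul _ _).symm
      _ ≤ _ := Real.exp_le_exp.2 (by linarith)
  have h12 : (1 : ℝ) ≤ 3 * C.size * Real.exp (-(t ^ 2 / 25)) := by
    have : 2 * (C.size : ℝ) * (24 / 25 : ℝ) ^ K ≤ 2 * C.size * Real.exp (-(t ^ 2 / 25)) := by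
      gcongr
    have h0 : (0 : ℝ) ≤ C.size * Real.exp (-(t ^ 2 / 25)) := by positivity
    nlinarith
  have h13 : Real.exp (t ^ 2 / 25) ≤ 3 * C.size := by
    have h14 := mul_le_mul_of_nonneg_right h12 (Real.exp_pos (t ^ 2 / 25)).le
    rwa [one_mul, mul_assoc, ← Real.exp_add, neg_add_cancel, Real.exp_zero, mul_one] at h14
  have h15 : 3 * Real.exp (16 * t) ≤ Real.exp (t ^ 2 / 25) := by
    have h16 : (3 : ℝ) ≤ Real.exp 2 := by
      have := Real.add_one_le_exp (2 : ℝ)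
      linarith
    calc 3 * Real.exp (16 * t) ≤ Real.exp 2 * Real.exp (16 * t) := by gcongr
      _ = Real.exp (2 + 16 * t) := (Real.exp_add _ _).symm
      _ ≤ _ := Real.exp_le_exp.2 (by nlinarith)
  linarith

end Numerics

end CircuitBound

theorem mainTheorem1 :
    ∃ c : ℝ, 0 < c ∧
      ∀ m Δ : ℕ → ℕ,
        Filter.Tendsto m Filter.atTop Filter.atTop →
        (∀ r : ℕ, 1 ≤ Δ r) →
        (∀ ε : ℝ, 0 < ε → ∀ᶠ r in Filter.atTop, (Δ r : ℝ) ≤ (m r : ℝ) ^ ε) →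
        ∀ᶠ r in Filter.atTop,
          ∀ (F : Type*) [Field F] (σ : Type*) (e : HardPoly.Vars (m r) (Δ r) ↪ σ)
            (C : Circuit F σ),
            C.IsMultilinear →
            C.productDepth ≤ Δ r →
            C.Computes (MvPolynomial.rename e (HardPoly.hardPoly F (m r) (Δ r))) →
            Real.exp ((m r : ℝ) ^ c) ≤ (C.size : ℝ) ∧
              Real.exp ((HardPoly.numVars (m r) (Δ r) : ℝ) ^ (c / (Δ r : ℝ))) ≤ (C.size : ℝ) := by
  -- With t = m^(1/8) eventually Δ ≤ t. The factor 16 in exp(16t) absorbs the second bound, since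
  -- n^(1/(8Δ)) ≤ (16m)^(1/8) ≤ 16t.
  refine ⟨1 / 8, by norm_num, fun m Δ hm hΔ hsmall => ?_⟩
  have hlarge : ∀ᶠ r in Filter.atTop, 1000 ≤ (m r : ℝ) ^ (1 / 8 : ℝ) :=
    ((tendsto_rpow_atTop (by norm_num : (0 : ℝ) < 1 / 8)).comp
      (tendsto_natCast_atTop_atTop.comp hm)).eventually_ge_atTop 1000
  filter_upwards [hlarge, hsmall (1 / 8) (by norm_num)] with r hr hΔr F _ σ e C hC hd hP
  have hm0 : (0 : ℝ) ≤ m r := Nat.cast_nonneg _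
  have ht : (m r : ℝ) = ((m r : ℝ) ^ (1 / 8 : ℝ)) ^ 8 := by
    rw [← Real.rpow_natCast, ← Real.rpow_mul hm0]
    norm_num
  have h := CircuitBound.exp_le_size (m r) (Δ r) _ hr ht (hΔ r) hΔr e C hC hd hP
  refine ⟨le_trans (Real.exp_le_exp.2 (by linarith)) h, le_trans (Real.exp_le_exp.2 ?_) h⟩
  have hΔ0 : (0 : ℝ) < Δ r := by exact_mod_cast hΔ r
  have h1 : (HardPoly.numVars (m r) (Δ r) : ℝ) ≤ (16 * (m r : ℝ)) ^ (Δ r : ℝ) := by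
    rw [HardPoly.numVars_eq, Real.rpow_natCast]
    push_cast
    calc (8 : ℝ) * (2 * m r) ^ Δ r ≤ 8 ^ Δ r * (2 * m r) ^ Δ r := by
          gcongr
          exact le_self_pow₀ (by norm_num) (by have := hΔ r; omega)
      _ = (16 * (m r : ℝ)) ^ Δ r := by rw [← mul_pow]; ring
  calc (HardPoly.numVars (m r) (Δ r) : ℝ) ^ (1 / 8 / (Δ r : ℝ))
      ≤ ((16 * (m r : ℝ)) ^ (Δ r : ℝ)) ^ (1 / 8 / (Δ r : ℝ)) :=
        Real.rpow_le_rpow (Nat.cast_nonneg _) h1 (by positivity)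
    _ = (16 * (m r : ℝ)) ^ (1 / 8 : ℝ) := by
        rw [← Real.rpow_mul (by positivity)]
        congr 1
        field_simp
    _ = 16 ^ (1 / 8 : ℝ) * (m r : ℝ) ^ (1 / 8 : ℝ) := Real.mul_rpow (by norm_num) hm0
    _ ≤ 16 * (m r : ℝ) ^ (1 / 8 : ℝ) := by
        gcongr
        calc (16 : ℝ) ^ (1 / 8 : ℝ) ≤ 16 ^ (1 : ℝ) :=
              Real.rpow_le_rpow_of_exponent_le (by norm_num) (by norm_num)
          _ = 16 := Real.rpow_one _
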